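/- Let $K$ be an algebraically closed field of characteristic $p\ge 0$, let $S=\bigoplus_{d\in\mathbb N^r}S_d$ be a commutative, finitely generated, $\mathbb N^r$-graded $K$-algebra with $S_0=K$ (and $S \neq 0$), and let $G$ be a finite group acting on $S$ by $K$-algebra automorphisms that preserve the grading. Let $R=S^G$, with $R_d=R\cap S_d$. For a homogeneous ideal $N\subseteq R$ put $H(N,t)=\sum_{d}\dim_K(N\cap R_d)\,t^d$, where $t=(t_1,\dots,t_r)$. The universal denominator $\operatorname{udenom}(R,t)$ is the smallest polynomial $B(t)\in\mathbb Z[t_1,\dots,t_r]$ with respect to divisibility such that $B(0)=1$ and $B(t)H(N,t)$ is a Laurent polynomial for every homogeneous ideal $N\subseteq R$. For $n\ge 1$ let $\phi_n$ be the $n$-th cyclotomic polynomial, with sign chosen such that $\phi_n(0)=1$; for $0\ne d\in\mathbb N^r$ with $k=\gcd(d_1,\dots,d_r)$ let $\phi_d(t)=\phi_k(t^{d/k})$, and let $\phi_0=1$. Let $Y=\operatorname{Hom}_{K\text{-alg}}(S,K)$ be the affine variety of $S$, with the action $(g\cdot y)(f)=y(g^{-1}\cdot f)$ of $G$ and the action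 of the torus $T=(K^*)^r$ given by $(t\cdot y)(f)=t^{-e}y(f)$ for $f\in S_e$. For $d\in\mathbb N^r$ let $T^{[d]}=\{t\in T\mid t^d=1\}$, and for $g\in G$, $\zeta\in T$ let $Y^g_\zeta=\{y\in Y\mid g\cdot y=\zeta\cdot y\}$. Then $\operatorname{udenom}(S^G,t)$ exists and can be written as $\prod_{d\in\mathbb N^r}\phi_d(t)^{m_d}$ with $m_d\in\mathbb N$, almost all zero. For every such expression, every $d\in\mathbb N^r$ that is not divisible by $p$ (that is, $p\nmid d_i$ for some $i$; when $p=0$ this means $d\neq 0$), and every $\zeta\in T^{[d]}$ that generates a Zariski dense subgroup of $T^{[d]}$, one has $$m_d=\max_{g\in G}\dim Y^g_\zeta .$$ -/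

import Mathlib

open scoped BigOperators

noncomputable section

namespace UDenom

/-! ### Hilbert series and universal denominators -/

section Hilbert

variable {K R : Type*} [Field K] [CommRing R] [Algebra K R] {r : ℕ}

/-- The Hilbert series of an ideal `N` of an `ℕ^r`-graded `K`-algebra `R`: the coefficient of
`t^d` is `dim_K (N ∩ R_d)`. -/
def hilbertSeries (𝓡 : (Fin r →₀ ℕ) → Submodule K R) (N : Ideal R) :
    MvPowerSeries (Fin r) ℤ :=
  fun d => (Module.finrank K ↥(N.restrictScalars K ⊓ 𝓡 d) : ℤ)

/-- `B(0) = 1`, and `B(t) H(N,t)` is a Laurent polynomial for every graded submodule `N` of `R`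
(that is, every homogeneous ideal). As `R` is graded by `ℕ^r`, `B(t) H(N,t)` is a power series,
so it is a Laurent polynomial exactly if it is a polynomial. -/
structure ClearsDenominators (𝓡 : (Fin r →₀ ℕ) → Submodule K R) [GradedAlgebra 𝓡]
    (B : MvPolynomial (Fin r) ℤ) : Prop where
  constantCoeff_eq_one : MvPolynomial.constantCoeff B = 1
  exists_polynomial : ∀ N : Ideal R, N.IsHomogeneous 𝓡 →
    ∃ A : MvPolynomial (Fin r) ℤ,
      (B : MvPowerSeries (Fin r) ℤ) * hilbertSeries 𝓡 N = (A : MvPowerSeries (Fin r) ℤ)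

/-- `B` is the universal denominator of `R` (as a graded module over itself): the smallest
polynomial, with respect to divisibility, that clears all denominators. -/
structure IsUDenom (𝓡 : (Fin r →₀ ℕ) → Submodule K R) [GradedAlgebra 𝓡]
    (B : MvPolynomial (Fin r) ℤ) : Prop where
  clears : ClearsDenominators 𝓡 B
  dvd_of_clears : ∀ B' : MvPolynomial (Fin r) ℤ, ClearsDenominators 𝓡 B' → B ∣ B'

end Hilbert

/-! ### The polynomials `φ_d` -/

/-- The `n`-th cyclotomic polynomial, with the sign that makes the constant term `1`. -/
def phiOne (n : ℕ) : Polynomial ℤ :=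
  if n = 1 then 1 - Polynomial.X else Polynomial.cyclotomic n ℤ

/-- The greatest common divisor of the entries of `d`. -/
def vecGcd {r : ℕ} (d : Fin r →₀ ℕ) : ℕ := Finset.univ.gcd d

/-- `φ_d(t) = φ_k(t^{d/k})` with `k = gcd(d_1,…,d_r)`; by convention `φ_0 = 1`. -/
def phi {r : ℕ} (d : Fin r →₀ ℕ) : MvPolynomial (Fin r) ℤ :=
  Polynomial.aeval
    (MvPolynomial.monomial (d.mapRange (fun a => a / vecGcd d) (Nat.zero_div _)) (1 : ℤ))
    (phiOne (vecGcd d))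

/-! ### The torus -/

section Torus

variable {K : Type*} [Field K] {r : ℕ}

/-- The character `t ↦ t^d` of the torus `(K^*)^r`. -/
def character (d : Fin r →₀ ℕ) : (Fin r → Kˣ) →* Kˣ where
  toFun t := ∏ i, t i ^ d i
  map_one' := by simp
  map_mul' s t := by simp [mul_pow, Finset.prod_mul_distrib]

/-- The kernel `T^{[d]}` of the character `t ↦ t^d`. -/
def torusKer (K : Type*) [Field K] {r : ℕ} (d : Fin r →₀ ℕ) : Subgroup (Fin r → Kˣ) :=
  (character d).ker

/-- The Zariski closure in the torus `T = (K^*)^r` of a subset. The Zariski topology of `T` is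
induced by that of the affine space `K^r`. -/
def zariskiClosure (A : Set (Fin r → Kˣ)) : Set (Fin r → Kˣ) :=
  {t | ∀ P : MvPolynomial (Fin r) K,
    (∀ s ∈ A, MvPolynomial.eval (fun i => (s i : K)) P = 0) →
      MvPolynomial.eval (fun i => (t i : K)) P = 0}

/-- `ζ` lies in `T^{[d]}` and generates a Zariski dense subgroup of it. -/
def GeneratesDense (d : Fin r →₀ ℕ) (ζ : Fin r → Kˣ) : Prop :=
  ζ ∈ torusKer K d ∧
    zariskiClosure (Subgroup.zpowers ζ : Set (Fin r → Kˣ)) = (torusKer K d : Set (Fin r → Kˣ))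

end Torus

/-! ### The affine variety of a graded algebra -/

section Variety

variable {K S : Type*} [Field K] [CommRing S] [Algebra K S] {r : ℕ}

/-- The action of `t` in the torus on `S`: multiplication by `t^e` on the component `S_e`. -/
def torusAct (𝒜 : (Fin r →₀ ℕ) → Submodule K S) [GradedAlgebra 𝒜] (t : Fin r → Kˣ) :
    S →ₐ[K] S :=
  (DirectSum.toAlgebra K (fun e => 𝒜 e)
    (fun e => ((character e t : Kˣ) : K) • (𝒜 e).subtype)
    (by simp [character])
    (by
      intro i j a b
      simp [character, pow_add, Finset.prod_mul_distrib, smul_smul, mul_comm])).comp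
    (DirectSum.decomposeAlgEquiv 𝒜).toAlgHom

theorem torusAct_of_mem (𝒜 : (Fin r →₀ ℕ) → Submodule K S) [GradedAlgebra 𝒜]
    (t : Fin r → Kˣ) {e : Fin r →₀ ℕ} {f : S} (hf : f ∈ 𝒜 e) :
    torusAct 𝒜 t f = ((character e t : Kˣ) : K) • f := by
  simp only [torusAct, AlgHom.comp_apply]
  change (DirectSum.toAlgebra K _ _ _ _) (DirectSum.decompose 𝒜 f) = _
  rw [DirectSum.decompose_of_mem 𝒜 hf]
  exact DirectSum.toAddMonoid_of
    (fun e => (((character e t : Kˣ) : K) • (𝒜 e).subtype).toAddMonoidHom) e ⟨f, hf⟩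

/-- The action of the torus on the points of `Y`, `(t · y)(f) = y(t⁻¹ · f)`. A point of the
affine variety `Y` of `S` is a `K`-algebra homomorphism `S → K`. -/
def torusPoint (𝒜 : (Fin r →₀ ℕ) → Submodule K S) [GradedAlgebra 𝒜] (t : Fin r → Kˣ)
    (y : S →ₐ[K] K) : S →ₐ[K] K :=
  y.comp (torusAct 𝒜 t⁻¹)

/-- The action of a group on the points of `Y`, `(g · y)(f) = y(g⁻¹ · f)`. -/
def groupPoint {G : Type*} [Group G] [MulSemiringAction G S] [SMulCommClass G K S] (g : G)
    (y : S →ₐ[K] K) : S →ₐ[K] K :=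
  y.comp (MulSemiringAction.toAlgHom K S g⁻¹)

/-- The set `Y^g_ζ = {y ∈ Y | g · y = ζ · y}`. -/
def eigenLocus {G : Type*} [Group G] [MulSemiringAction G S] [SMulCommClass G K S]
    (𝒜 : (Fin r →₀ ℕ) → Submodule K S) [GradedAlgebra 𝒜] (g : G) (ζ : Fin r → Kˣ) :
    Set (S →ₐ[K] K) :=
  {y | groupPoint g y = torusPoint 𝒜 ζ y}

/-- The ideal of all functions in `S` that vanish on a set of points. -/
def vanishingIdeal (Z : Set (S →ₐ[K] K)) : Ideal S :=
  ⨅ y ∈ Z, RingHom.ker y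

/-- The dimension of (the Zariski closure of) a set `Z` of points: the Krull dimension of its
coordinate ring. -/
def algDim (Z : Set (S →ₐ[K] K)) : WithBot ℕ∞ :=
  ringKrullDim (S ⧸ vanishingIdeal Z)

end Variety

/-! ### The invariant ring -/

section Invariants

variable (G : Type*) {K S : Type*} [Field K] [CommRing S] [Algebra K S] [Group G]
  [MulSemiringAction G S] [SMulCommClass G K S] {r : ℕ}

/-- The action of `G` respects the grading. -/
class GradedAction (𝒜 : (Fin r →₀ ℕ) → Submodule K S) : Prop where
  smul_mem : ∀ (g : G) (d : Fin r →₀ ℕ) (f : S), f ∈ 𝒜 d → g • f ∈ 𝒜 d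

/-- The graded pieces `(S^G)_d = S^G ∩ S_d` of the invariant ring `S^G`. -/
def invGrading (𝒜 : (Fin r →₀ ℕ) → Submodule K S) (d : Fin r →₀ ℕ) :
    Submodule K (FixedPoints.subalgebra K S G) :=
  (𝒜 d).comap (FixedPoints.subalgebra K S G).val.toLinearMap

theorem decompose_smul (𝒜 : (Fin r →₀ ℕ) → Submodule K S) [GradedAlgebra 𝒜]
    [GradedAction G 𝒜] (g : G) (f : S) (d : Fin r →₀ ℕ) :
    (DirectSum.decompose 𝒜 (g • f) d : S) = g • (DirectSum.decompose 𝒜 f d : S) := by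
  induction f using DirectSum.Decomposition.inductionOn 𝒜 with
  | zero => simp
  | @homogeneous e m =>
    have h : g • (m : S) ∈ 𝒜 e := GradedAction.smul_mem g e _ m.2
    by_cases hed : e = d
    · subst hed
      rw [DirectSum.decompose_of_mem_same 𝒜 h, DirectSum.decompose_of_mem_same 𝒜 m.2]
    · rw [DirectSum.decompose_of_mem_ne 𝒜 h hed, DirectSum.decompose_of_mem_ne 𝒜 m.2 hed,
        smul_zero]
  | add a b ha hb => simp [smul_add, DirectSum.decompose_add, ha, hb]

theorem decompose_mem (𝒜 : (Fin r →₀ ℕ) → Submodule K S) [GradedAlgebra 𝒜]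
    [GradedAction G 𝒜] (f : FixedPoints.subalgebra K S G) (d : Fin r →₀ ℕ) :
    (DirectSum.decompose 𝒜 (f : S) d : S) ∈ FixedPoints.subalgebra K S G := by
  intro g
  rw [← decompose_smul G 𝒜 g (f : S) d, f.2 g]

instance invGrading_gradedMonoid (𝒜 : (Fin r →₀ ℕ) → Submodule K S) [GradedAlgebra 𝒜] :
    SetLike.GradedMonoid (invGrading G 𝒜) where
  one_mem := SetLike.GradedOne.one_mem (A := 𝒜)
  mul_mem _ _ _ _ ha hb := SetLike.GradedMul.mul_mem (A := 𝒜) ha hb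

theorem invGrading_isInternal (𝒜 : (Fin r →₀ ℕ) → Submodule K S) [GradedAlgebra 𝒜]
    [GradedAction G 𝒜] : DirectSum.IsInternal (invGrading G 𝒜) := by
  have key : ∀ (x : DirectSum (Fin r →₀ ℕ) fun d => invGrading G 𝒜 d) (d : Fin r →₀ ℕ),
      ((x d : FixedPoints.subalgebra K S G) : S) =
        DirectSum.decompose 𝒜 ((DirectSum.coeAddMonoidHom (invGrading G 𝒜) x :
          FixedPoints.subalgebra K S G) : S) d := by
    intro x d
    induction x using DirectSum.induction_on with
    | zero => simp
    | of e y =>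
      have hy : ((y : FixedPoints.subalgebra K S G) : S) ∈ 𝒜 e := y.2
      rw [DirectSum.coeAddMonoidHom_of]
      by_cases hed : e = d
      · subst hed
        rw [DirectSum.of_eq_same, DirectSum.decompose_of_mem_same 𝒜 hy]
      · rw [DirectSum.of_eq_of_ne _ _ _ (Ne.symm hed), DirectSum.decompose_of_mem_ne 𝒜 hy hed]
        rfl
    | add a b ha hb => simp [DirectSum.decompose_add, ha, hb]
  constructor
  · intro x y hxy
    refine DFinsupp.ext fun d => Subtype.ext (Subtype.ext ?_)
    rw [key x d, key y d, hxy]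
  · intro f
    classical
    refine ⟨∑ d ∈ (DirectSum.decompose 𝒜 (f : S)).support,
      DirectSum.of (fun d => invGrading G 𝒜 d) d
        ⟨⟨_, decompose_mem G 𝒜 f d⟩, (DirectSum.decompose 𝒜 (f : S) d).2⟩, ?_⟩
    apply Subtype.ext
    rw [map_sum]
    simp only [DirectSum.coeAddMonoidHom_of, AddSubmonoidClass.coe_finsetSum]
    exact DirectSum.sum_support_decompose 𝒜 (f : S)

/-- The grading of the invariant ring. -/
instance invGrading_gradedAlgebra (𝒜 : (Fin r →₀ ℕ) → Submodule K S) [GradedAlgebra 𝒜]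
    [GradedAction G 𝒜] : GradedAlgebra (invGrading G 𝒜) where
  toDecomposition := (invGrading_isInternal G 𝒜).chooseDecomposition

end Invariants

end UDenom

end

/-! Let R be a graded affine algebra with R_0 = K, and let V_d ⊆ Spec R be the locus where all
homogeneous elements of degree outside ℕd vanish. The heart of the proof is that, for d ≠ 0, the
multiplicity of φ_d in the universal denominator of R is dim V_d (`exists_isUDenom`). This makes
sense because φ_d is prime in ℤ[t] (`prime_phi`); it divides 1 - t^e exactly if e ∈ ℕd, and only
once if moreover e ≠ 0. So the Hilbert series, whose denominators are products of factors 1 - t^e,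
have a pole order along φ_d = 0.

Upper bound (`poleLE_quotSeries`): noetherian induction reduces to homogeneous ideals I modulo which
every homogeneous x ∉ I is a nonzerodivisor. Dividing out such an x of degree e multiplies the
series of R/I by 1 - t^e. If e ∉ ℕd, the pole order does not change. If all degrees of R/I lie in
ℕd, a factor with e ≠ 0 removes one order of the pole, and the dimension drops by at least one.

Lower bound (`ringKrullDim_le_of_poleLE`): a component of V_d of dimension s carries s algebraically
independent homogeneous elements, of degrees N_i d. Their monomials make the Hilbert series of V_d
dominate ∏ 1/(1 - X^{N_i}) with X = t^d, and letting X tend to 1 from below forces a pole of order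
at least s.

For R = S^G, a dense generator ζ of T^{[d]} satisfies ζ^e = 1 only for e ∈ ℕd
(`character_eq_one_iff`; this is where p ∤ d enters). Hence a point y of Y lies over V_d iff y and
ζ·y agree on S^G, that is, iff they are in one G-orbit (`offLine_le_comap_ker_iff`). The preimage of
V_d is therefore the union of the Y^g_ζ. As S is integral over S^G, dim V_d is the dimension of this
finite union, which is the maximum over g (`isGreatest_algDim_eigenLocus`). -/

noncomputable section

namespace UDenom

/-! ### Arithmetic of the polynomials φ_d -/

section Cyclotomic

open MvPolynomial

variable {r : ℕ}

theorem vecGcd_dvd (d : Fin r →₀ ℕ) (i : Fin r) : vecGcd d ∣ d i :=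
  Finset.gcd_dvd (Finset.mem_univ i)

theorem vecGcd_ne_zero {d : Fin r →₀ ℕ} (hd : d ≠ 0) : vecGcd d ≠ 0 := by
  intro h
  refine hd (Finsupp.ext fun i => ?_)
  have := vecGcd_dvd d i
  rw [h] at this
  simpa using this

/-- A nonzero exponent vector is a multiple of a primitive one. -/
theorem exists_eq_vecGcd_smul {d : Fin r →₀ ℕ} (hd : d ≠ 0) :
    ∃ (v : Fin r →₀ ℕ) (c : Fin r → ℤ), ∑ i, c i * v i = 1 ∧ d = vecGcd d • v := by
  refine ⟨d.mapRange (fun a => a / vecGcd d) (Nat.zero_div _), ?_⟩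
  have hk := vecGcd_ne_zero hd
  obtain ⟨c, hc⟩ := Finset.gcd_eq_sum_mul (R := ℤ) Finset.univ (fun i => (d i : ℤ))
  have hdiv : ∀ i, d i = vecGcd d * (d i / vecGcd d) := fun i =>
    (Nat.mul_div_cancel' (vecGcd_dvd d i)).symm
  have hg : (Finset.univ.gcd fun i => (d i : ℤ)) = (vecGcd d : ℤ) := by
    apply Int.natAbs_inj_of_nonneg_of_nonneg _ (by positivity) |>.mp
    · apply Nat.dvd_antisymm
      · rw [Int.natAbs_natCast]
        refine Finset.dvd_gcd fun i hi => ?_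
        have := Finset.gcd_dvd (f := fun i => (d i : ℤ)) hi
        simpa using Int.natAbs_dvd_natAbs.mpr this
      · apply Int.natAbs_dvd_natAbs.mpr
        refine Finset.dvd_gcd fun i _ => ?_
        exact_mod_cast vecGcd_dvd d i
    · rw [← Finset.normalize_gcd]
      exact Int.nonneg_of_normalize_eq_self (by simp)
  refine ⟨c, ?_, ?_⟩
  · rw [hg] at hc
    have h2 : (vecGcd d : ℤ) * ∑ i, c i * ((d i / vecGcd d : ℕ) : ℤ) = vecGcd d * 1 := by
      rw [mul_one, Finset.mul_sum]
      conv_rhs => rw [hc]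
      refine Finset.sum_congr rfl fun i _ => ?_
      conv_rhs => rw [hdiv i]
      push_cast
      ring
    simpa using mul_left_cancel₀ (by exact_mod_cast hk) h2
  · ext i
    simpa using hdiv i

theorem vecGcd_smul {v : Fin r →₀ ℕ} {c : Fin r → ℤ} (hc : ∑ i, c i * v i = 1) (k : ℕ) :
    vecGcd (k • v) = k := by
  have h1 : (vecGcd v : ℤ) ∣ 1 := by
    rw [← hc]
    refine Finset.dvd_sum fun i _ => Dvd.dvd.mul_left ?_ _
    exact_mod_cast vecGcd_dvd v i
  have h2 : vecGcd v = 1 := by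
    have : vecGcd v ∣ 1 := by exact_mod_cast h1
    simpa using this
  have h3 : vecGcd (k • v) = Finset.univ.gcd fun i => k * v i := rfl
  rw [h3, Finset.gcd_mul_left]
  change normalize k * vecGcd v = k
  simp [h2]

theorem phi_smul {v : Fin r →₀ ℕ} {c : Fin r → ℤ} (hc : ∑ i, c i * v i = 1) (k : ℕ) :
    phi (k • v) = Polynomial.aeval (monomial v (1 : ℤ)) (phiOne k) := by
  simp only [phi, vecGcd_smul hc k]
  rcases Nat.eq_zero_or_pos k with rfl | hk
  · simp [phiOne]
  · have h : (k • v).mapRange (fun a => a / k) (Nat.zero_div _) = v := by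
      ext i
      simp [Nat.mul_div_cancel_left _ hk]
    rw [h]

/-- Two integer vectors that are proportional to a primitive vector. -/
theorem eq_smul_of_proportional {v : Fin r → ℤ} {c : Fin r → ℤ} (hc : ∑ i, c i * v i = 1)
    {a : Fin r → ℤ} (ha : ∀ i j, v j * a i = v i * a j) (j : Fin r) :
    a j = (∑ i, c i * a i) * v j := by
  calc a j = (∑ i, c i * v i) * a j := by rw [hc, one_mul]
    _ = (∑ i, c i * a i) * v j := by
      rw [Finset.sum_mul, Finset.sum_mul]
      refine Finset.sum_congr rfl fun i _ => ?_
      rw [mul_assoc, ← ha i j]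
      ring

theorem exists_eq_smul_of_proportional {v : Fin r →₀ ℕ} {c : Fin r → ℤ}
    (hc : ∑ i, c i * v i = 1) {k : ℕ} (hk : 0 < k) {e : Fin r →₀ ℕ}
    (he : ∀ i j, (v j : ℤ) * e i = v i * e j) (hdvd : (k : ℤ) ∣ ∑ i, c i * (e i : ℤ)) :
    ∃ n : ℕ, e = n • k • v := by
  obtain ⟨n, hn⟩ := hdvd
  have h : ∀ j, (e j : ℤ) = k * n * v j := fun j => by
    rw [← hn]
    exact eq_smul_of_proportional (v := fun i => (v i : ℤ)) (a := fun i => (e i : ℤ)) hc he j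
  -- A negative n would force v = 0, since e and v have entries in ℕ, and v = 0 contradicts the
  -- Bezout relation.
  have hn0 : 0 ≤ n := by
    by_contra hneg
    push Not at hneg
    have hv0 : v = 0 := by
      ext j
      by_contra hne
      have h6 : (k : ℤ) * n < 0 := mul_neg_of_pos_of_neg (by exact_mod_cast hk) hneg
      have h7 : (0 : ℤ) < v j := by exact_mod_cast Nat.pos_of_ne_zero hne
      have h8 := mul_neg_of_neg_of_pos h6 h7
      have h9 : (0 : ℤ) ≤ e j := by positivity
      linarith [h j]
    simp [hv0] at hc
  lift n to ℕ using hn0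
  refine ⟨n, ?_⟩
  ext j
  simp only [Finsupp.smul_apply, smul_eq_mul]
  zify
  rw [h j]
  ring

/-- The class of an exponent vector modulo the line through `v`. -/
def lineClass (v : Fin r →₀ ℕ) : (Fin r →₀ ℕ) →+ (Fin r × Fin r → ℤ) where
  toFun a := fun x => v x.2 * a x.1 - v x.1 * a x.2
  map_zero' := by ext; simp
  map_add' a b := by ext; simp; ring

theorem eq_smul_of_lineClass_eq {v : Fin r →₀ ℕ} {c : Fin r → ℤ} (hc : ∑ i, c i * v i = 1)
    {a b : Fin r →₀ ℕ} (h : lineClass v a = lineClass v b) (j : Fin r) :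
    (a j : ℤ) = b j + (∑ i, c i * a i - ∑ i, c i * b i) * v j := by
  have := eq_smul_of_proportional (v := fun i => (v i : ℤ)) hc
    (a := fun i => (a i : ℤ) - b i) (fun i j => by
      have := congrFun h (i, j)
      simp only [lineClass, AddMonoidHom.coe_mk, ZeroHom.coe_mk] at this
      linarith) j
  simp only [mul_sub, Finset.sum_sub_distrib] at this
  linarith

theorem eq_add_smul_of_lineClass_eq {v : Fin r →₀ ℕ} {c : Fin r → ℤ} (hc : ∑ i, c i * v i = 1)
    {a b : Fin r →₀ ℕ} (h : lineClass v a = lineClass v b)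
    (hle : ∑ i, c i * (b i : ℤ) ≤ ∑ i, c i * (a i : ℤ)) :
    a = b + (∑ i, c i * (a i : ℤ) - ∑ i, c i * (b i : ℤ)).toNat • v := by
  ext j
  have := eq_smul_of_lineClass_eq hc h j
  have hadd : ∀ m : ℕ, (b + m • v) j = b j + m * v j := fun m => by simp
  rw [hadd]
  zify
  rw [Int.toNat_of_nonneg (by linarith)]
  exact this

/-- Restriction of Laurent polynomials to the generic point of the component
`t^v = η` of the torus. -/
def genericEval (v : Fin r →₀ ℕ) (c : Fin r → ℤ) (η : ℂˣ) :
    MvPolynomial (Fin r) ℤ →ₐ[ℤ] AddMonoidAlgebra ℂ (Fin r × Fin r → ℤ) :=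
  aeval fun i => AddMonoidAlgebra.single (lineClass v (Finsupp.single i 1)) ((η ^ c i : ℂˣ) : ℂ)

theorem genericEval_monomial (v : Fin r →₀ ℕ) (c : Fin r → ℤ) (η : ℂˣ) (a : Fin r →₀ ℕ) :
    genericEval v c η (monomial a 1) =
      AddMonoidAlgebra.single (lineClass v a) ((η ^ (∑ i, c i * a i) : ℂˣ) : ℂ) := by
  induction a using Finsupp.induction_linear with
  | zero =>
    rw [show (monomial (0 : Fin r →₀ ℕ) (1 : ℤ)) = 1 from rfl, map_one, AddMonoidAlgebra.one_def]
    simp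
  | add a b ha hb =>
    rw [show (monomial (a + b) (1 : ℤ)) = monomial a 1 * monomial b 1 by simp [monomial_mul],
      map_mul, ha, hb, AddMonoidAlgebra.single_mul_single, map_add]
    congr 1
    simp [mul_add, Finset.sum_add_distrib, zpow_add]
  | single i n =>
    rw [← X_pow_eq_monomial, map_pow, genericEval, aeval_X, AddMonoidAlgebra.single_pow,
      ← map_nsmul]
    congr 1
    · simp
    · rw [Finset.sum_eq_single i (by intro j _ hj; simp [Finsupp.single_eq_of_ne hj]) (by simp)]
      simp [zpow_mul]

theorem genericEval_aeval_monomial {v : Fin r →₀ ℕ} {c : Fin r → ℤ}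
    (hc : ∑ i, c i * v i = 1) (η : ℂˣ) (q : Polynomial ℤ) :
    genericEval v c η (Polynomial.aeval (monomial v (1 : ℤ)) q) =
      AddMonoidAlgebra.single 0 (Polynomial.aeval (η : ℂ) q) := by
  have h0 : lineClass v v = 0 := by ext; simp [lineClass]; ring
  rw [← Polynomial.aeval_algHom_apply, genericEval_monomial, hc, h0, zpow_one]
  have : (AddMonoidAlgebra.single (0 : Fin r × Fin r → ℤ) (η : ℂ)) =
    (AddMonoidAlgebra.singleZeroAlgHom (R := ℤ) (A := ℂ)) (η : ℂ) := rfl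
  rw [this, Polynomial.aeval_algHom_apply]
  rfl

theorem genericEval_eq_sum (v : Fin r →₀ ℕ) (c : Fin r → ℤ) (η : ℂˣ)
    (f : MvPolynomial (Fin r) ℤ) :
    genericEval v c η f = ∑ a ∈ f.support, AddMonoidAlgebra.single (lineClass v a)
      (((f.coeff a : ℤ) : ℂ) * ((η ^ (∑ i, c i * a i) : ℂˣ) : ℂ)) := by
  conv_lhs => rw [f.as_sum]
  rw [map_sum]
  refine Finset.sum_congr rfl fun a _ => ?_
  rw [show monomial a (f.coeff a) = f.coeff a • monomial a 1 by simp [smul_monomial],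
    map_smul, genericEval_monomial, AddMonoidAlgebra.smul_single, zsmul_eq_mul]

/-- Up to sign, `phiOne k` is the minimal polynomial of η over ℤ. -/
theorem cyclotomic_dvd_iff {k : ℕ} (hk : 0 < k) {η : ℂˣ} (hη : IsPrimitiveRoot (η : ℂ) k)
    (q : Polynomial ℤ) : phiOne k ∣ q ↔ Polynomial.aeval (η : ℂ) q = 0 := by
  have h : phiOne k ∣ q ↔ Polynomial.cyclotomic k ℤ ∣ q := by
    rw [phiOne]
    split_ifs with h1
    · subst h1
      rw [Polynomial.cyclotomic_one, ← neg_dvd, neg_sub]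
    · rfl
  rw [h, Polynomial.cyclotomic_eq_minpoly hη hk, minpoly.isIntegrallyClosed_dvd_iff]
  exact hη.isIntegral hk

/-- Monomials of f in different classes modulo the line through v stay independent under the
evaluation, so each class can be treated alone. Within one class f is t^b g(t^v), and the claim
becomes the one-variable statement that g(η) = 0 iff the cyclotomic polynomial divides g. -/
theorem phi_dvd_iff_genericEval_eq_zero {v : Fin r →₀ ℕ} {c : Fin r → ℤ}
    (hc : ∑ i, c i * v i = 1) {k : ℕ} (hk : 0 < k) {η : ℂˣ} (hη : IsPrimitiveRoot (η : ℂ) k)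
    (f : MvPolynomial (Fin r) ℤ) : phi (k • v) ∣ f ↔ genericEval v c η f = 0 := by
  classical
  rw [phi_smul hc]
  constructor
  · rintro ⟨g, rfl⟩
    rw [map_mul, genericEval_aeval_monomial hc,
      (cyclotomic_dvd_iff hk hη _).mp dvd_rfl]
    simp
  intro hf
  rw [f.as_sum, ← Finset.sum_fiberwise_of_maps_to (t := f.support.image (lineClass v))
    (g := lineClass v) (fun a ha => Finset.mem_image_of_mem _ ha)]
  refine Finset.dvd_sum fun x hx => ?_
  set s := f.support.filter fun a => lineClass v a = x with hs
  have hsum : ∑ a ∈ s, ((f.coeff a : ℤ) : ℂ) * ((η ^ (∑ i, c i * (a i : ℤ)) : ℂˣ) : ℂ) = 0 := by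
    have h1 := DFunLike.congr_fun (congrArg AddMonoidAlgebra.coeff hf) x
    rw [genericEval_eq_sum, AddMonoidAlgebra.coeff_sum, Finsupp.finsetSum_apply] at h1
    rw [hs, Finset.sum_filter]
    simpa only [AddMonoidAlgebra.coeff_single, Finsupp.single_apply, AddMonoidAlgebra.coeff_zero,
      Finsupp.coe_zero, Pi.zero_apply] using h1
  have hne : s.Nonempty := by
    obtain ⟨a, ha, hax⟩ := Finset.mem_image.mp hx
    exact ⟨a, Finset.mem_filter.mpr ⟨ha, hax⟩⟩
  -- The Bezout form measures the position on the line. Taking b lowest makes every other exponent b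
  -- + n v with n ≥ 0, so that g below is a polynomial.
  obtain ⟨b, hb, hmin⟩ := s.exists_min_image (fun a => ∑ i, c i * (a i : ℤ)) hne
  have hcl : ∀ a ∈ s, lineClass v a = lineClass v b := fun a ha => by
    rw [(Finset.mem_filter.mp ha).2, (Finset.mem_filter.mp hb).2]
  let n : (Fin r →₀ ℕ) → ℕ := fun a => (∑ i, c i * (a i : ℤ) - ∑ i, c i * (b i : ℤ)).toNat
  have hn : ∀ a ∈ s, a = b + n a • v := fun a ha =>
    eq_add_smul_of_lineClass_eq hc (hcl a ha) (hmin a ha)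
  let g : Polynomial ℤ := ∑ a ∈ s, Polynomial.C (f.coeff a) * Polynomial.X ^ n a
  have hg : ∑ a ∈ s, monomial a (f.coeff a) =
      monomial b 1 * Polynomial.aeval (monomial v (1 : ℤ)) g := by
    simp only [g, map_sum, Finset.mul_sum]
    refine Finset.sum_congr rfl fun a ha => ?_
    conv_lhs => rw [hn a ha]
    rw [map_mul, map_pow, Polynomial.aeval_X, Polynomial.aeval_C, monomial_pow, one_pow,
      ← hn a ha, algebraMap_eq, C_mul_monomial, monomial_mul, ← hn a ha]
    simp
  rw [hg]
  refine Dvd.dvd.mul_left (map_dvd _ ((cyclotomic_dvd_iff hk hη g).mpr ?_)) _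
  have h2 : ((η ^ (∑ i, c i * (b i : ℤ)) : ℂˣ) : ℂ) * Polynomial.aeval (η : ℂ) g = 0 := by
    rw [← hsum]
    simp only [g, map_sum, Finset.mul_sum]
    refine Finset.sum_congr rfl fun a ha => ?_
    have h3 : (n a : ℤ) = ∑ i, c i * (a i : ℤ) - ∑ i, c i * (b i : ℤ) :=
      Int.toNat_of_nonneg (by linarith [hmin a ha])
    have h4 : (η : ℂˣ) ^ (∑ i, c i * (a i : ℤ)) = η ^ (∑ i, c i * (b i : ℤ)) * η ^ n a := by
      rw [← zpow_natCast, h3, ← zpow_add]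
      congr 1
      ring
    rw [h4]
    simp
    ring
  exact (mul_eq_zero.mp h2).resolve_left (Units.ne_zero _)

/-- The data of a nonzero exponent vector: a primitive vector, a Bezout relation and a
primitive root of unity. -/
theorem exists_genericEval {d : Fin r →₀ ℕ} (hd : d ≠ 0) :
    ∃ (v : Fin r →₀ ℕ) (c : Fin r → ℤ) (k : ℕ) (η : ℂˣ), ∑ i, c i * (v i : ℤ) = 1 ∧ d = k • v ∧
      0 < k ∧ IsPrimitiveRoot (η : ℂ) k ∧ ∀ f, phi d ∣ f ↔ genericEval v c η f = 0 := by
  obtain ⟨v, c, hc, hv⟩ := exists_eq_vecGcd_smul hd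
  have hk : 0 < vecGcd d := Nat.pos_of_ne_zero (vecGcd_ne_zero hd)
  have hη := Complex.isPrimitiveRoot_exp (vecGcd d) hk.ne'
  obtain ⟨η, hη'⟩ := hη.isUnit hk.ne'
  rw [← hη'] at hη
  refine ⟨v, c, vecGcd d, η, hc, hv, hk, hη, fun f => ?_⟩
  conv_lhs => rw [hv]
  exact phi_dvd_iff_genericEval_eq_zero hc hk hη f

theorem constantCoeff_phi (d : Fin r →₀ ℕ) : constantCoeff (phi d) = 1 := by
  rcases eq_or_ne d 0 with rfl | hd
  · have : vecGcd (0 : Fin r →₀ ℕ) = 0 := Finset.gcd_eq_zero_iff.mpr fun _ _ => rfl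
    simp [phi, phiOne, this]
  obtain ⟨v, c, hc, hv⟩ := exists_eq_vecGcd_smul hd
  have hv0 : v ≠ 0 := by
    rintro rfl
    simp at hc
  rw [hv, phi_smul hc]
  change (constantCoeff.toIntAlgHom : MvPolynomial (Fin r) ℤ →ₐ[ℤ] ℤ) _ = 1
  rw [← Polynomial.aeval_algHom_apply]
  have : (constantCoeff.toIntAlgHom : MvPolynomial (Fin r) ℤ →ₐ[ℤ] ℤ) (monomial v 1) = 0 := by
    simp [constantCoeff_monomial, hv0]
  rw [this, Polynomial.aeval_def, Polynomial.eval₂_at_zero, phiOne]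
  split_ifs with h
  · simp
  · have := vecGcd_ne_zero hd
    simp [Polynomial.cyclotomic_coeff_zero ℤ (show 1 < vecGcd d by omega)]

theorem phi_ne_zero (d : Fin r →₀ ℕ) : phi d ≠ 0 := by
  intro h
  have := constantCoeff_phi d
  simp [h] at this

/-- The multiples of φ_d are the kernel of a homomorphism into the group algebra of a torsion-free
abelian group over ℂ, which is a domain. -/
theorem prime_phi {d : Fin r →₀ ℕ} (hd : d ≠ 0) : Prime (phi d) := by
  obtain ⟨v, c, k, η, -, -, -, -, h⟩ := exists_genericEval hd
  refine ⟨phi_ne_zero d, fun hu => ?_, fun a b hab => ?_⟩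
  · have := (h 1).mp hu.dvd
    simp at this
  · rw [h, map_mul, mul_eq_zero] at hab
    simpa [h] using hab

/-- At the generic point of t^v = η the monomial t^e is a basis element of the group algebra times a
power of η. It is 1 iff e is parallel to v and k divides the Bezout form of e. -/
theorem phi_dvd_one_sub_monomial_iff {d : Fin r →₀ ℕ} (hd : d ≠ 0) (e : Fin r →₀ ℕ) :
    phi d ∣ 1 - monomial e 1 ↔ ∃ n : ℕ, e = n • d := by
  obtain ⟨v, c, k, η, hc, hv, hk, hη, h⟩ := exists_genericEval hd
  rw [h, map_sub, map_one, sub_eq_zero, genericEval_monomial, AddMonoidAlgebra.one_def]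
  constructor
  · intro h1
    rcases AddMonoidAlgebra.single_inj.mp h1 with ⟨h2, h3⟩ | ⟨h2, -⟩
    · have h3' : (η : ℂˣ) ^ (∑ i, c i * (e i : ℤ)) = 1 := Units.ext h3.symm
      have h4 : (k : ℤ) ∣ ∑ i, c i * (e i : ℤ) :=
        ((IsPrimitiveRoot.coe_units_iff.mp hη).zpow_eq_one_iff_dvd _).mp h3'
      rw [hv]
      refine exists_eq_smul_of_proportional hc hk (fun i j => ?_) h4
      have h5 := congrFun h2 (i, j)
      simp only [lineClass, AddMonoidHom.coe_mk, ZeroHom.coe_mk, Pi.zero_apply] at h5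
      linarith
    · simp at h2
  · rintro ⟨n, rfl⟩
    have h0 : lineClass v v = 0 := by ext; simp [lineClass]; ring
    rw [hv, map_nsmul, map_nsmul, h0, smul_zero, smul_zero]
    congr 1
    have h6 : ∑ i, c i * (((n • k • v) i : ℕ) : ℤ) = (n * k : ℕ) := by
      have : ∀ i, c i * (((n • k • v) i : ℕ) : ℤ) = (n * k : ℕ) * (c i * v i) := fun i => by
        simp
        ring
      simp only [this, ← Finset.mul_sum, hc, mul_one]
    rw [h6, zpow_natCast, mul_comm, pow_mul]
    simp [hη.pow_eq_one]

theorem one_sub_aeval_monomial (d : Fin r →₀ ℕ) (n : ℕ) :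
    (1 - monomial (n • d) 1 : MvPolynomial (Fin r) ℤ) =
      Polynomial.aeval (monomial d (1 : ℤ)) (1 - Polynomial.X ^ n : Polynomial ℤ) := by
  simp [monomial_pow]

/-- `φ_d` divides `q(t^d)` exactly if `q(1) = 0`. -/
theorem phi_dvd_aeval_monomial_iff {d : Fin r →₀ ℕ} (hd : d ≠ 0) (q : Polynomial ℤ) :
    phi d ∣ Polynomial.aeval (monomial d (1 : ℤ)) q ↔ q.eval 1 = 0 := by
  obtain ⟨v, c, k, η, hc, hv, hk, hη, h⟩ := exists_genericEval hd
  have h1 : monomial d (1 : ℤ) = Polynomial.aeval (monomial v (1 : ℤ))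
      (Polynomial.X ^ k : Polynomial ℤ) := by
    simp [monomial_pow, hv]
  have h2 : Polynomial.aeval (monomial d (1 : ℤ)) q =
      Polynomial.aeval (monomial v (1 : ℤ)) (q.comp (Polynomial.X ^ k : Polynomial ℤ)) := by
    rw [Polynomial.aeval_comp, ← h1]
  rw [h, h2, genericEval_aeval_monomial hc, Polynomial.aeval_comp]
  simp only [map_pow, Polynomial.aeval_X, hη.pow_eq_one]
  have h3 : Polynomial.aeval (1 : ℂ) q = ((q.eval 1 : ℤ) : ℂ) := by
    have := Polynomial.aeval_algebraMap_apply ℂ (1 : ℤ) q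
    simpa [Polynomial.coe_aeval_eq_eval] using this
  simp [h3]

/-- `φ_d` divides `1 - t^d` exactly once. -/
theorem one_sub_monomial_eq_phi_mul {d : Fin r →₀ ℕ} (hd : d ≠ 0) :
    ∃ C : MvPolynomial (Fin r) ℤ, ¬ phi d ∣ C ∧ 1 - monomial d 1 = phi d * C := by
  obtain ⟨v, c, k, η, hc, hv, hk, hη, h⟩ := exists_genericEval hd
  have hX : Polynomial.aeval (η : ℂ) (1 - Polynomial.X ^ k : Polynomial ℤ) = 0 := by
    simp [hη.pow_eq_one]
  obtain ⟨q, hq⟩ := (cyclotomic_dvd_iff hk hη _).mpr hX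
  refine ⟨Polynomial.aeval (monomial v (1 : ℤ)) q, ?_, ?_⟩
  · rw [h, genericEval_aeval_monomial hc]
    intro h0
    have h1 : Polynomial.aeval (η : ℂ) q = 0 := by simpa using h0
    -- If η were also a root of q, it would be a double root of 1 - X^k; but the derivative -k
    -- X^(k-1) does not vanish at η.
    have h2 := congrArg (fun p => Polynomial.aeval (η : ℂ) (Polynomial.derivative p)) hq
    simp only [Polynomial.derivative_mul, map_add, map_mul, h1,
      (cyclotomic_dvd_iff hk hη _).mp dvd_rfl] at h2
    simp [Polynomial.derivative_X_pow, hk.ne'] at h2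
  · rw [hv, phi_smul hc, ← map_mul, ← hq, one_sub_aeval_monomial]

theorem one_sub_monomial_smul_eq_phi_mul {d : Fin r →₀ ℕ} (hd : d ≠ 0) {n : ℕ} (hn : n ≠ 0) :
    ∃ C : MvPolynomial (Fin r) ℤ, ¬ phi d ∣ C ∧ 1 - monomial (n • d) 1 = phi d * C := by
  obtain ⟨C, hC, h⟩ := one_sub_monomial_eq_phi_mul hd
  have hgeom : (1 - Polynomial.X ^ n : Polynomial ℤ) =
      (1 - Polynomial.X) * ∑ i ∈ Finset.range n, Polynomial.X ^ i :=
    (mul_neg_geom_sum _ _).symm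
  refine ⟨C * Polynomial.aeval (monomial d (1 : ℤ))
    (∑ i ∈ Finset.range n, Polynomial.X ^ i : Polynomial ℤ), ?_, ?_⟩
  · intro hdvd
    rcases (prime_phi hd).dvd_or_dvd hdvd with h1 | h1
    · exact hC h1
    · rw [phi_dvd_aeval_monomial_iff hd] at h1
      simp [Polynomial.eval_finsetSum, hn] at h1
  · rw [one_sub_aeval_monomial, hgeom, map_mul, ← mul_assoc, ← h]
    simp

/-- Since φ_e divides 1 - t^e, e is a multiple of d. Primes dividing each other are associated, so
the argument runs in both directions. -/
theorem eq_of_phi_dvd_phi {d e : Fin r →₀ ℕ} (hd : d ≠ 0) (he : e ≠ 0) (h : phi d ∣ phi e) :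
    d = e := by
  have key : ∀ {d e : Fin r →₀ ℕ}, d ≠ 0 → e ≠ 0 → phi d ∣ phi e → ∃ n : ℕ, e = n • d := by
    intro d e hd he h
    obtain ⟨C, -, hC⟩ := one_sub_monomial_eq_phi_mul he
    exact (phi_dvd_one_sub_monomial_iff hd e).mp (h.trans ⟨C, hC⟩)
  obtain ⟨n, hn⟩ := key hd he h
  obtain ⟨m, hm⟩ := key he hd ((prime_phi hd).associated_of_dvd (prime_phi he) h).symm.dvd
  ext i
  have h1 := DFunLike.congr_fun hn i
  have h2 := DFunLike.congr_fun hm i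
  simp only [Finsupp.smul_apply, smul_eq_mul] at h1 h2
  exact Nat.dvd_antisymm (Dvd.intro_left _ h1.symm) (Dvd.intro_left _ h2.symm)

/-- `1 - t^e` is a product of polynomials `φ_d`. -/
theorem one_sub_monomial_eq_prod {e : Fin r →₀ ℕ} (he : e ≠ 0) :
    ∃ s : Finset (Fin r →₀ ℕ), 0 ∉ s ∧ (1 - monomial e 1 : MvPolynomial (Fin r) ℤ) =
      ∏ d ∈ s, phi d := by
  classical
  obtain ⟨v, c, hc, hv⟩ := exists_eq_vecGcd_smul he
  have hv0 : v ≠ 0 := by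
    rintro rfl
    simp at hc
  set k := vecGcd e with hk
  have hk0 : 0 < k := Nat.pos_of_ne_zero (vecGcd_ne_zero he)
  have hinj : Function.Injective fun j : ℕ => j • v := fun i j hij => by
    rw [← vecGcd_smul hc i, ← vecGcd_smul hc j]
    exact congrArg _ hij
  refine ⟨k.divisors.image fun j => j • v, ?_, ?_⟩
  · simp only [Finset.mem_image, not_exists, not_and]
    intro j hj h0
    rw [← zero_smul ℕ v] at h0
    exact (Nat.pos_of_mem_divisors hj).ne' (hinj h0)
  · rw [Finset.prod_image fun i _ j _ hij => hinj hij, hv, one_sub_aeval_monomial]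
    simp only [phi_smul hc, ← map_prod]
    congr 1
    have h1 : (1 : ℕ) ∈ k.divisors := by simp [hk0.ne']
    rw [← Finset.mul_prod_erase _ _ h1]
    have h2 := Polynomial.prod_cyclotomic_eq_X_pow_sub_one hk0 ℤ
    rw [← Finset.mul_prod_erase _ _ h1, Polynomial.cyclotomic_one] at h2
    have h3 : ∏ x ∈ k.divisors.erase 1, phiOne x =
        ∏ x ∈ k.divisors.erase 1, Polynomial.cyclotomic x ℤ :=
      Finset.prod_congr rfl fun x hx => by rw [phiOne, if_neg (Finset.ne_of_mem_erase hx)]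
    rw [h3, phiOne, if_pos rfl, ← neg_sub, ← h2, ← neg_mul, neg_sub]

end Cyclotomic

/-! ### Pole orders of integral power series along φ_d = 0 -/

section Series

variable {r : ℕ}

/-- A power series that is a polynomial. -/
def IsPoly (F : MvPowerSeries (Fin r) ℤ) : Prop :=
  ∃ A : MvPolynomial (Fin r) ℤ, F = (A : MvPowerSeries (Fin r) ℤ)

theorem IsPoly.add {F F' : MvPowerSeries (Fin r) ℤ} (h : IsPoly F) (h' : IsPoly F') :
    IsPoly (F + F') := by
  obtain ⟨A, rfl⟩ := h
  obtain ⟨A', rfl⟩ := h'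
  exact ⟨A + A', by push_cast; rfl⟩

theorem IsPoly.mul_left {F : MvPowerSeries (Fin r) ℤ} (h : IsPoly F)
    (B : MvPolynomial (Fin r) ℤ) : IsPoly ((B : MvPowerSeries (Fin r) ℤ) * F) := by
  obtain ⟨A, rfl⟩ := h
  exact ⟨B * A, by push_cast; rfl⟩

theorem IsPoly.of_dvd {F : MvPowerSeries (Fin r) ℤ} {B C : MvPolynomial (Fin r) ℤ}
    (h : IsPoly ((B : MvPowerSeries (Fin r) ℤ) * F)) (hBC : B ∣ C) :
    IsPoly ((C : MvPowerSeries (Fin r) ℤ) * F) := by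
  obtain ⟨D, rfl⟩ := hBC
  convert h.mul_left D using 1
  push_cast
  ring

theorem isPoly_zero : IsPoly (0 : MvPowerSeries (Fin r) ℤ) := ⟨0, by simp⟩

/-- The order of the pole of `F` along `φ_d = 0` is at most `n`. -/
def PoleLE (d : Fin r →₀ ℕ) (n : ℕ) (F : MvPowerSeries (Fin r) ℤ) : Prop :=
  ∃ C : MvPolynomial (Fin r) ℤ, ¬ phi d ∣ C ∧
    IsPoly (((phi d ^ n * C : MvPolynomial (Fin r) ℤ) : MvPowerSeries (Fin r) ℤ) * F)

variable {d : Fin r →₀ ℕ} {n : ℕ} {F F' : MvPowerSeries (Fin r) ℤ}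

theorem PoleLE.add (hd : d ≠ 0) (h : PoleLE d n F) (h' : PoleLE d n F') :
    PoleLE d n (F + F') := by
  obtain ⟨C, hC, hF⟩ := h
  obtain ⟨C', hC', hF'⟩ := h'
  refine ⟨C * C', fun h => ((prime_phi hd).dvd_or_dvd h).elim hC hC', ?_⟩
  rw [mul_add]
  exact (hF.of_dvd ⟨C', by ring⟩).add (hF'.of_dvd ⟨C, by ring⟩)

theorem PoleLE.mul_left (h : PoleLE d n F) (B : MvPolynomial (Fin r) ℤ) :
    PoleLE d n ((B : MvPowerSeries (Fin r) ℤ) * F) := by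
  obtain ⟨C, hC, hF⟩ := h
  refine ⟨C, hC, ?_⟩
  rw [mul_left_comm]
  exact hF.mul_left B

theorem IsPoly.poleLE (hd : d ≠ 0) (h : IsPoly F) : PoleLE d n F :=
  ⟨1, fun h1 => (prime_phi hd).not_isUnit (isUnit_of_dvd_one h1), h.mul_left _⟩

theorem PoleLE.of_mul {B : MvPolynomial (Fin r) ℤ} (hd : d ≠ 0) (hB : ¬ phi d ∣ B)
    (h : PoleLE d n ((B : MvPowerSeries (Fin r) ℤ) * F)) : PoleLE d n F := by
  obtain ⟨C, hC, hF⟩ := h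
  refine ⟨C * B, fun h => ((prime_phi hd).dvd_or_dvd h).elim hC hB, ?_⟩
  convert hF using 1
  push_cast
  ring

theorem PoleLE.of_phi_mul
    (h : PoleLE d n ((phi d : MvPowerSeries (Fin r) ℤ) * F)) : PoleLE d (n + 1) F := by
  obtain ⟨C, hC, hF⟩ := h
  refine ⟨C, hC, ?_⟩
  convert hF using 1
  push_cast
  ring

/-- If `φ_d^b B` clears the denominator of `F`, then `b` can be replaced by any bound for the
order of the pole along `φ_d = 0`. -/
theorem PoleLE.isPoly_mul (hd : d ≠ 0) (h : PoleLE d n F) {b : ℕ} {B : MvPolynomial (Fin r) ℤ}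
    (hB : IsPoly (((phi d ^ b * B : MvPolynomial (Fin r) ℤ) : MvPowerSeries (Fin r) ℤ) * F)) :
    IsPoly (((phi d ^ n * B : MvPolynomial (Fin r) ℤ) : MvPowerSeries (Fin r) ℤ) * F) := by
  rcases le_total b n with hbn | hbn
  · exact hB.of_dvd (mul_dvd_mul_right (pow_dvd_pow _ hbn) _)
  obtain ⟨k, rfl⟩ := Nat.exists_eq_add_of_le hbn
  obtain ⟨C, hC, A', hA'⟩ := h
  obtain ⟨A, hA⟩ := hB
  -- Both sides are the polynomial φ_d^(n+k) B C F. As C is prime to φ_d, the factor φ_d^k must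
  -- divide A and can be cancelled.
  have h1 : C * A = phi d ^ k * (A' * B) := by
    apply MvPolynomial.coe_injective (Fin r) ℤ
    push_cast at hA hA' ⊢
    rw [← hA, ← hA']
    ring
  obtain ⟨A₂, rfl⟩ := (prime_phi hd).pow_dvd_of_dvd_mul_left k hC ⟨_, h1⟩
  refine ⟨A₂, ?_⟩
  have h2 : ((phi d ^ k : MvPolynomial (Fin r) ℤ) : MvPowerSeries (Fin r) ℤ) ≠ 0 := by
    rw [Ne, MvPolynomial.coe_eq_zero_iff]
    exact pow_ne_zero _ (phi_ne_zero d)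
  apply mul_left_cancel₀ h2
  push_cast at hA ⊢
  rw [← hA]
  ring

end Series

/-! ### Rank–nullity for the restriction of a map to a subspace -/

section LinearAlgebra

variable {K M N : Type*} [Field K] [AddCommGroup M] [Module K M] [AddCommGroup N] [Module K N]

theorem finrank_map_add_finrank_ker_inf (f : M →ₗ[K] N) (V : Submodule K M)
    [Module.Finite K V] :
    Module.finrank K (V.map f) + Module.finrank K ↥(LinearMap.ker f ⊓ V) =
      Module.finrank K V := by
  have h := LinearMap.finrank_range_add_finrank_ker (f.domRestrict V)
  rw [LinearMap.range_domRestrict, LinearMap.ker_domRestrict] at h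
  rw [← h, inf_comm, ← Submodule.map_comap_subtype, Submodule.finrank_map_subtype_eq]

end LinearAlgebra

/-! ### Ideal quotients by an element -/

section Colon

variable {R : Type*} [CommRing R]

/-- The ideal quotient `(I : x)`. -/
def colonElem (I : Ideal R) (x : R) : Ideal R :=
  Submodule.comap (LinearMap.mulLeft R x) I

theorem mem_colonElem {I : Ideal R} {x a : R} : a ∈ colonElem I x ↔ x * a ∈ I := Iff.rfl

theorem le_colonElem (I : Ideal R) (x : R) : I ≤ colonElem I x :=
  fun _ ha => I.mul_mem_left x ha

end Colon

/-! ### Hilbert series of quotients and the upper bound for the pole order -/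

section Hilbert

variable {K R : Type*} [Field K] [CommRing R] [Algebra K R] {r : ℕ}
  (𝓡 : (Fin r →₀ ℕ) → Submodule K R)

/-- The Hilbert series of the quotient `R ⧸ I`. -/
def quotSeries (I : Ideal R) : MvPowerSeries (Fin r) ℤ :=
  hilbertSeries 𝓡 ⊤ - hilbertSeries 𝓡 I

theorem coeff_quotSeries (I : Ideal R) (c : Fin r →₀ ℕ) :
    MvPowerSeries.coeff c (quotSeries 𝓡 I) =
      (Module.finrank K (𝓡 c) : ℤ) - Module.finrank K ↥(I.restrictScalars K ⊓ 𝓡 c) := by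
  have h : (⊤ : Ideal R).restrictScalars K ⊓ 𝓡 c = 𝓡 c := by simp
  change (Module.finrank K ↥((⊤ : Ideal R).restrictScalars K ⊓ 𝓡 c) : ℤ) -
    Module.finrank K ↥(I.restrictScalars K ⊓ 𝓡 c) = _
  rw [h]

theorem quotSeries_top : quotSeries 𝓡 ⊤ = 0 := by simp [quotSeries]

theorem hilbertSeries_eq (I : Ideal R) :
    hilbertSeries 𝓡 I = quotSeries 𝓡 ⊥ - quotSeries 𝓡 I := by
  have : hilbertSeries 𝓡 (⊥ : Ideal R) = 0 := by
    funext c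
    have h : (⊥ : Ideal R).restrictScalars K ⊓ 𝓡 c = ⊥ := by simp
    change (Module.finrank K ↥((⊥ : Ideal R).restrictScalars K ⊓ 𝓡 c) : ℤ) = 0
    rw [h]
    simp
  simp [quotSeries, this]

theorem isPoly_quotSeries_of_forall_le {I : Ideal R}
    (h : ∀ e, e ≠ 0 → 𝓡 e ≤ I.restrictScalars K) : IsPoly (quotSeries 𝓡 I) := by
  refine ⟨MvPolynomial.C (MvPowerSeries.coeff 0 (quotSeries 𝓡 I)), ?_⟩
  ext c
  rcases eq_or_ne c 0 with rfl | hc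
  · rw [MvPolynomial.coeff_coe, MvPolynomial.coeff_C, if_pos rfl]
  · rw [MvPolynomial.coeff_coe, MvPolynomial.coeff_C, if_neg hc.symm, coeff_quotSeries,
      inf_eq_right.mpr (h c hc), sub_self]

variable [GradedAlgebra 𝓡]

/-- Finitely many elements of R_d generate the ideal spanned by R_d. Taking degree d parts in an
expression by these generators leaves only coefficients in R_0 = K. -/
theorem finite_piece [IsNoetherianRing R] (h0 : 𝓡 0 = 1) (d : Fin r →₀ ℕ) :
    Module.Finite K (𝓡 d) := by
  classical
  obtain ⟨s, hs, hspan⟩ := (Submodule.fg_span_iff_fg_span_finset_subset (R := R)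
    (𝓡 d : Set R)).mp (IsNoetherian.noetherian _)
  have h : 𝓡 d = Submodule.span K (s : Set R) := by
    refine le_antisymm (fun f hf => ?_) (Submodule.span_le.mpr hs)
    have hf' : f ∈ Submodule.span R (s : Set R) := hspan ▸ Submodule.subset_span hf
    obtain ⟨a, -, ha⟩ := Submodule.mem_span_finset.mp hf'
    rw [← DirectSum.decompose_of_mem_same 𝓡 hf, ← ha, DirectSum.decompose_sum,
      DFinsupp.finsetSum_apply, AddSubmonoidClass.coe_finsetSum]
    refine Submodule.sum_mem _ fun x hx => ?_
    have h1 := DirectSum.coe_decompose_mul_of_right_mem_of_le 𝓡 (a := a x) (hs hx) le_rfl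
    rw [tsub_self] at h1
    rw [smul_eq_mul, h1]
    obtain ⟨y, hy⟩ := Submodule.mem_one.mp (h0.le (SetLike.coe_mem (DirectSum.decompose 𝓡 (a x) 0)))
    rw [← hy, ← Algebra.smul_def]
    exact Submodule.smul_mem _ _ (Submodule.subset_span hx)
  rw [h]
  exact Module.Finite.span_finset K s

theorem isHomogeneous_colonElem {I : Ideal R} (hI : I.IsHomogeneous 𝓡) {e : Fin r →₀ ℕ} {x : R}
    (hx : x ∈ 𝓡 e) : (colonElem I x).IsHomogeneous 𝓡 := by
  intro i a ha
  have h := DirectSum.coe_decompose_mul_of_left_mem_of_le 𝓡 (b := a) hx (le_add_right le_rfl :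
    e ≤ e + i)
  rw [add_tsub_cancel_left] at h
  rw [mem_colonElem, ← h]
  exact hI _ ha

theorem isHomogeneous_sup_span {I : Ideal R} (hI : I.IsHomogeneous 𝓡) {e : Fin r →₀ ℕ} {x : R}
    (hx : x ∈ 𝓡 e) : (I ⊔ Ideal.span {x}).IsHomogeneous 𝓡 := by
  refine hI.sup (Ideal.homogeneous_span 𝓡 _ fun y hy => ?_)
  rw [Set.mem_singleton_iff.mp hy]
  exact ⟨e, hx⟩

/-- The homogeneous elements of `I + (x)`. -/
theorem mem_sup_span_iff {I : Ideal R} (hI : I.IsHomogeneous 𝓡) {e : Fin r →₀ ℕ} {x : R}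
    (hx : x ∈ 𝓡 e) {c : Fin r →₀ ℕ} {z : R} (hz : z ∈ 𝓡 c) :
    z ∈ I ⊔ Ideal.span {x} ↔
      z ∈ I ∨ ∃ c', c = e + c' ∧ ∃ a ∈ 𝓡 c', z - x * a ∈ I := by
  constructor
  · intro h
    obtain ⟨i, hi, w, hw, rfl⟩ := Submodule.mem_sup.mp h
    obtain ⟨a, rfl⟩ := Ideal.mem_span_singleton'.mp hw
    have h1 := DirectSum.decompose_of_mem_same 𝓡 hz
    rw [DirectSum.decompose_add, DirectSum.add_apply, AddMemClass.coe_add] at h1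
    by_cases hec : e ≤ c
    · right
      refine ⟨c - e, (add_tsub_cancel_of_le hec).symm, _,
        SetLike.coe_mem (DirectSum.decompose 𝓡 a (c - e)), ?_⟩
      rw [DirectSum.coe_decompose_mul_of_right_mem_of_le 𝓡 hx hec] at h1
      rw [← h1, mul_comm x, add_sub_cancel_right]
      exact hI c hi
    · left
      rw [DirectSum.coe_decompose_mul_of_right_mem_of_not_le 𝓡 hx hec, add_zero] at h1
      rw [← h1]
      exact hI c hi
  · rintro (h | ⟨c', -, a, -, h⟩)
    · exact Ideal.mem_sup_left h
    · rw [← sub_add_cancel z (x * a)]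
      exact add_mem (Ideal.mem_sup_left h)
        (Ideal.mem_sup_right (Ideal.mul_mem_right _ _ (Ideal.mem_span_singleton_self x)))

/-- Dimension count for the exact sequence 0 → (R/(I : x))(-e) → R/I → R/(I + (x)) → 0, whose first
map is multiplication by x. -/
theorem quotSeries_eq_add [IsNoetherianRing R] (h0 : 𝓡 0 = 1) {I : Ideal R}
    (hI : I.IsHomogeneous 𝓡) {e : Fin r →₀ ℕ} {x : R} (hx : x ∈ 𝓡 e) :
    quotSeries 𝓡 I = quotSeries 𝓡 (I ⊔ Ideal.span {x}) +
      ((MvPolynomial.monomial e 1 : MvPolynomial (Fin r) ℤ) : MvPowerSeries (Fin r) ℤ) *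
        quotSeries 𝓡 (colonElem I x) := by
  have := finite_piece 𝓡 h0
  ext c
  rw [map_add, MvPolynomial.coe_monomial, MvPowerSeries.coeff_monomial_mul, one_mul,
    coeff_quotSeries, coeff_quotSeries]
  set W : Submodule K R := (I ⊔ Ideal.span {x}).restrictScalars K ⊓ 𝓡 c with hW
  have hWfin : Module.Finite K W := Submodule.finiteDimensional_of_le inf_le_right
  have h1 := finrank_map_add_finrank_ker_inf (I.restrictScalars K).mkQ W
  have h2 : LinearMap.ker (I.restrictScalars K).mkQ ⊓ W = I.restrictScalars K ⊓ 𝓡 c := by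
    rw [Submodule.ker_mkQ, hW, ← inf_assoc]
    congr 1
    exact inf_eq_left.mpr (fun z hz => Ideal.mem_sup_left hz)
  rw [h2] at h1
  split_ifs with hec
  · obtain ⟨c', rfl⟩ := exists_add_of_le hec
    rw [add_tsub_cancel_left, coeff_quotSeries]
    let μ : R →ₗ[K] R ⧸ I.restrictScalars K :=
      (I.restrictScalars K).mkQ ∘ₗ LinearMap.mulLeft K x
    have h3 := finrank_map_add_finrank_ker_inf μ (𝓡 c')
    have h4 : LinearMap.ker μ = (colonElem I x).restrictScalars K := by
      ext a
      simp [μ, mem_colonElem]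
    have h5 : W.map (I.restrictScalars K).mkQ = (𝓡 c').map μ := by
      ext w
      simp only [Submodule.mem_map]
      constructor
      · rintro ⟨z, ⟨hz, hzc⟩, rfl⟩
        rcases (mem_sup_span_iff 𝓡 hI hx hzc).mp hz with h | ⟨c'', hc'', a, ha, h⟩
        · refine ⟨0, zero_mem _, ?_⟩
          rw [map_zero, eq_comm]
          exact (Submodule.Quotient.mk_eq_zero _).mpr h
        · obtain rfl : c' = c'' := add_left_cancel hc''
          exact ⟨a, ha, ((Submodule.Quotient.eq _).mpr h).symm⟩
      · rintro ⟨a, ha, rfl⟩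
        exact ⟨x * a, ⟨Ideal.mem_sup_right
          (Ideal.mul_mem_right _ _ (Ideal.mem_span_singleton_self x)),
          SetLike.GradedMul.mul_mem hx ha⟩, rfl⟩
    rw [h4] at h3
    rw [h5] at h1
    omega
  · have h3 : W = I.restrictScalars K ⊓ 𝓡 c := by
      refine le_antisymm (fun z hz => ⟨?_, hz.2⟩)
        (inf_le_inf_right _ fun z hz => Ideal.mem_sup_left hz)
      rcases (mem_sup_span_iff 𝓡 hI hx hz.2).mp hz.1 with h | ⟨c', rfl, -⟩
      · exact h
      · exact absurd (le_add_right le_rfl) hec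
    rw [h3, add_zero]

theorem one_sub_monomial_mul_quotSeries [IsNoetherianRing R] (h0 : 𝓡 0 = 1) {I : Ideal R}
    (hI : I.IsHomogeneous 𝓡) {e : Fin r →₀ ℕ} {x : R} (hx : x ∈ 𝓡 e)
    (hcolon : colonElem I x ≤ I) :
    ((1 - MvPolynomial.monomial e 1 : MvPolynomial (Fin r) ℤ) : MvPowerSeries (Fin r) ℤ) *
      quotSeries 𝓡 I = quotSeries 𝓡 (I ⊔ Ideal.span {x}) := by
  have h := quotSeries_eq_add 𝓡 h0 hI hx
  rw [le_antisymm hcolon (le_colonElem I x)] at h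
  have hsub : ((1 - MvPolynomial.monomial e 1 : MvPolynomial (Fin r) ℤ) :
      MvPowerSeries (Fin r) ℤ) = 1 - ((MvPolynomial.monomial e 1 : MvPolynomial (Fin r) ℤ) :
      MvPowerSeries (Fin r) ℤ) := by
    have := map_sub (MvPolynomial.coeToMvPowerSeries.ringHom (σ := Fin r) (R := ℤ)) 1
      (MvPolynomial.monomial e 1)
    simpa using this
  rw [hsub, sub_mul, one_mul]
  nth_rewrite 1 [h]
  ring

theorem lt_sup_span {I : Ideal R} {x : R} (hx : x ∉ I) : I < I ⊔ Ideal.span {x} :=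
  lt_of_le_not_ge le_sup_left fun h =>
    hx (h (Ideal.mem_sup_right (Ideal.mem_span_singleton_self x)))

/-- Noetherian induction over the homogeneous ideals. -/
theorem homogeneous_induction [IsNoetherianRing R] {P : (I : Ideal R) → I.IsHomogeneous 𝓡 → Prop}
    (split : ∀ (I : Ideal R) (hI : I.IsHomogeneous 𝓡) (e : Fin r →₀ ℕ) (x : R) (hx : x ∈ 𝓡 e),
      P (I ⊔ Ideal.span {x}) (isHomogeneous_sup_span 𝓡 hI hx) →
      P (colonElem I x) (isHomogeneous_colonElem 𝓡 hI hx) → P I hI)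
    (prime : ∀ (I : Ideal R) (hI : I.IsHomogeneous 𝓡),
      (∀ e, ∀ x ∈ 𝓡 e, x ∉ I → colonElem I x ≤ I) →
      (∀ (I' : Ideal R) (hI' : I'.IsHomogeneous 𝓡), I < I' → P I' hI') → P I hI)
    (I : Ideal R) (hI : I.IsHomogeneous 𝓡) : P I hI := by
  induction I using WellFoundedGT.induction with
  | ind I ih =>
    by_cases h : ∀ e, ∀ x ∈ 𝓡 e, x ∉ I → colonElem I x ≤ I
    -- In this case every homogeneous element outside I is a nonzerodivisor modulo I.
    · exact prime I hI h fun I' hI' hlt => ih I' hlt hI'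
    · push Not at h
      obtain ⟨e, x, hx, hxI, hc⟩ := h
      exact split I hI e x hx (ih _ (lt_sup_span hxI) (isHomogeneous_sup_span 𝓡 hI hx))
        (ih _ (lt_of_le_not_ge (le_colonElem I x) hc) (isHomogeneous_colonElem 𝓡 hI hx))

/-- Hilbert–Serre: the Hilbert series of `R ⧸ I` is a rational function whose denominator is a
product of factors `1 - t^e`, where `R ⧸ I` has elements of degree `e`. -/
theorem exists_isPoly_prod_mul_quotSeries [IsNoetherianRing R] (h0 : 𝓡 0 = 1) (I : Ideal R)
    (hI : I.IsHomogeneous 𝓡) :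
    ∃ l : Multiset (Fin r →₀ ℕ), (∀ e ∈ l, e ≠ 0 ∧ ¬ 𝓡 e ≤ I.restrictScalars K) ∧
      IsPoly ((((l.map fun e => 1 - MvPolynomial.monomial e 1).prod : MvPolynomial (Fin r) ℤ) :
        MvPowerSeries (Fin r) ℤ) * quotSeries 𝓡 I) := by
  induction I, hI using homogeneous_induction 𝓡 with
  | split I hI e x hx h1 h2 =>
    obtain ⟨l₁, hl₁, hp₁⟩ := h1
    obtain ⟨l₂, hl₂, hp₂⟩ := h2
    refine ⟨l₁ + l₂, fun e he => ?_, ?_⟩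
    · rcases Multiset.mem_add.mp he with h | h
      · exact ⟨(hl₁ e h).1, fun hle => (hl₁ e h).2
          (hle.trans fun z hz => Ideal.mem_sup_left hz)⟩
      · exact ⟨(hl₂ e h).1, fun hle => (hl₂ e h).2 (hle.trans fun z hz => le_colonElem I x hz)⟩
    · rw [quotSeries_eq_add 𝓡 h0 hI hx, mul_add, Multiset.map_add, Multiset.prod_add]
      refine (hp₁.of_dvd (dvd_mul_right _ _)).add ?_
      rw [mul_left_comm]
      exact (hp₂.of_dvd (dvd_mul_left _ _)).mul_left _
  | prime I hI hprime ih =>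
    by_cases h : ∀ e, e ≠ 0 → 𝓡 e ≤ I.restrictScalars K
    · exact ⟨0, by simp, by simpa using isPoly_quotSeries_of_forall_le 𝓡 h⟩
    · push Not at h
      obtain ⟨e, he, hle⟩ := h
      obtain ⟨x, hx, hxI⟩ := SetLike.not_le_iff_exists.mp hle
      obtain ⟨l, hl, hp⟩ := ih _ (isHomogeneous_sup_span 𝓡 hI hx) (lt_sup_span hxI)
      refine ⟨e ::ₘ l, fun e' he' => ?_, ?_⟩
      · rcases Multiset.mem_cons.mp he' with rfl | h'
        · exact ⟨he, hle⟩
        · exact ⟨(hl e' h').1, fun hle => (hl e' h').2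
            (hle.trans fun z hz => Ideal.mem_sup_left hz)⟩
      · rw [← one_sub_monomial_mul_quotSeries 𝓡 h0 hI hx (hprime e x hx hxI)] at hp
        convert hp using 1
        rw [Multiset.map_cons, Multiset.prod_cons, MvPolynomial.coe_mul]
        ring

/-- The ideal generated by the components whose degree is not a multiple of `d`. -/
def offLine (d : Fin r →₀ ℕ) : Ideal R :=
  Ideal.span {f | ∃ e, (¬ ∃ n : ℕ, e = n • d) ∧ f ∈ 𝓡 e}

theorem isHomogeneous_offLine (d : Fin r →₀ ℕ) : (offLine 𝓡 d).IsHomogeneous 𝓡 :=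
  Ideal.homogeneous_span 𝓡 _ fun _ ⟨e, _, hf⟩ => ⟨e, hf⟩

theorem ringKrullDim_quotient_mono {I J : Ideal R} (h : I ≤ J) :
    ringKrullDim (R ⧸ J) ≤ ringKrullDim (R ⧸ I) :=
  ringKrullDim_le_of_surjective (Ideal.Quotient.factor h) (Ideal.Quotient.factor_surjective h)

/-- The hypothesis says that x is a nonzerodivisor modulo I, so it lies in no minimal prime over I
and dividing by it lowers the dimension. -/
theorem ringKrullDim_quotient_sup_span_add_one_le {I : Ideal R} {x : R}
    (hcolon : colonElem I x ≤ I) :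
    ringKrullDim (R ⧸ (I ⊔ Ideal.span {x})) + 1 ≤ ringKrullDim (R ⧸ I) := by
  refine ringKrullDim_succ_le_of_surjective (Ideal.Quotient.factor le_sup_left)
    (Ideal.Quotient.factor_surjective le_sup_left) (r := Ideal.Quotient.mk I x) ?_ ?_
  · rw [mem_nonZeroDivisors_iff_right]
    intro z hz
    obtain ⟨a, rfl⟩ := Ideal.Quotient.mk_surjective z
    rw [← map_mul, Ideal.Quotient.eq_zero_iff_mem, mul_comm] at hz
    exact Ideal.Quotient.eq_zero_iff_mem.mpr (hcolon hz)
  · rw [Ideal.Quotient.factor_mk, Ideal.Quotient.eq_zero_iff_mem]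
    exact Ideal.mem_sup_right (Ideal.mem_span_singleton_self x)

/-- The order of the pole along `φ_d = 0` of the Hilbert series of `R ⧸ I` is at most the
dimension of the locus in `R ⧸ I` where the degrees off the line through `d` vanish. -/
theorem poleLE_quotSeries [IsNoetherianRing R] (h0 : 𝓡 0 = 1) {d : Fin r →₀ ℕ} (hd : d ≠ 0)
    (I : Ideal R) (hI : I.IsHomogeneous 𝓡) :
    ∀ n : ℕ, ringKrullDim (R ⧸ (I ⊔ offLine 𝓡 d)) ≤ n → PoleLE d n (quotSeries 𝓡 I) := by
  induction I, hI using homogeneous_induction 𝓡 with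
  | split I hI e x hx h1 h2 =>
    intro n hn
    rw [quotSeries_eq_add 𝓡 h0 hI hx]
    exact (h1 n ((ringKrullDim_quotient_mono (sup_le_sup_right le_sup_left _)).trans hn)).add hd
      ((h2 n ((ringKrullDim_quotient_mono
        (sup_le_sup_right (le_colonElem I x) _)).trans hn)).mul_left _)
  | prime I hI hprime ih =>
    intro n hn
    -- Either all degrees occurring in R/I lie on the line, so that a nonzerodivisor of nonzero
    -- degree lowers both pole order and dimension; or some x ∉ I has degree off the line, and 1 -
    -- t^e is prime to φ_d.
    by_cases hoff : offLine 𝓡 d ≤ I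
    · rw [sup_eq_left.mpr hoff] at hn
      by_cases h : ∀ e, e ≠ 0 → 𝓡 e ≤ I.restrictScalars K
      · exact (isPoly_quotSeries_of_forall_le 𝓡 h).poleLE hd
      push Not at h
      obtain ⟨e, he, hle⟩ := h
      obtain ⟨x, hx, hxI⟩ := SetLike.not_le_iff_exists.mp hle
      have hcolon := hprime e x hx hxI
      have hmul := one_sub_monomial_mul_quotSeries 𝓡 h0 hI hx hcolon
      have hdim := (ringKrullDim_quotient_sup_span_add_one_le hcolon).trans hn
      obtain ⟨k, rfl⟩ : ∃ k : ℕ, e = k • d := by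
        by_contra hne
        exact hxI (hoff (Ideal.subset_span ⟨e, hne, hx⟩))
      have hk : k ≠ 0 := by
        rintro rfl
        simp at he
      obtain ⟨C, hC, hCeq⟩ := one_sub_monomial_smul_eq_phi_mul hd hk
      rw [hCeq] at hmul
      have hle' : I ⊔ Ideal.span {x} ⊔ offLine 𝓡 d = I ⊔ Ideal.span {x} :=
        sup_eq_left.mpr (hoff.trans le_sup_left)
      have hpole : ∀ m : ℕ, ringKrullDim (R ⧸ (I ⊔ Ideal.span {x})) ≤ m →
          PoleLE d (m + 1) (quotSeries 𝓡 I) := fun m hm => by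
        have := ih _ (isHomogeneous_sup_span 𝓡 hI hx) (lt_sup_span hxI) m (by rwa [hle'])
        rw [← hmul, MvPolynomial.coe_mul, mul_assoc] at this
        refine PoleLE.of_phi_mul (PoleLE.of_mul hd hC ?_)
        convert this using 1
        ring
      -- For n = 0 no order is left to spend: R/(I + (x)) would have dimension below 0, so it is the
      -- zero ring, and the series of R/I vanishes.
      rcases n with _ | m
      · have htop : I ⊔ Ideal.span {x} = ⊤ := by
          by_contra hne
          have := Ideal.Quotient.nontrivial_iff.mpr hne
          have h1 := ringKrullDim_nonneg_of_nontrivial (R := R ⧸ (I ⊔ Ideal.span {x}))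
          have h2 : (0 : WithBot ℕ∞) + 1 ≤ 0 := (add_le_add_left h1 1).trans (by simpa using hdim)
          norm_num at h2
        rw [htop, quotSeries_top, ← hCeq] at hmul
        rcases mul_eq_zero.mp hmul with h1 | h1
        · rw [MvPolynomial.coe_eq_zero_iff, hCeq] at h1
          rcases mul_eq_zero.mp h1 with h2 | h2
          · exact absurd h2 (phi_ne_zero d)
          · exact absurd (h2 ▸ dvd_zero _) hC
        · rw [h1]
          exact isPoly_zero.poleLE hd
      · refine hpole m ?_
        push_cast at hdim
        exact ENat.WithBot.add_le_add_one_right_iff.mp hdim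
    · obtain ⟨x, ⟨e, hne, hx⟩, hxI⟩ : ∃ x ∈ {f | ∃ e, (¬ ∃ n : ℕ, e = n • d) ∧ f ∈ 𝓡 e},
          x ∉ I := by
        by_contra hcon
        exact hoff (Ideal.span_le.mpr fun f hf => by_contra fun hfI => hcon ⟨f, hf, hfI⟩)
      have hmul := one_sub_monomial_mul_quotSeries 𝓡 h0 hI hx (hprime e x hx hxI)
      have := ih _ (isHomogeneous_sup_span 𝓡 hI hx) (lt_sup_span hxI) n
        ((ringKrullDim_quotient_mono (sup_le_sup_right le_sup_left _)).trans hn)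
      rw [← hmul] at this
      exact this.of_mul hd (fun hdvd => hne ((phi_dvd_one_sub_monomial_iff hd e).mp hdvd))

end Hilbert

/-! ### Pole orders at 1 from growth on the real interval (0, 1) -/

section RealValues

/-- Absolute convergence of an integral power series at the real number `u`. -/
def SummableAt (u : ℝ) (f : PowerSeries ℤ) : Prop :=
  Summable fun k => ‖((PowerSeries.coeff k f : ℤ) : ℝ) * u ^ k‖

/-- The value of an integral power series at the real number `u`. -/
def seriesValue (u : ℝ) (f : PowerSeries ℤ) : ℝ :=
  ∑' k, ((PowerSeries.coeff k f : ℤ) : ℝ) * u ^ k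

variable {u : ℝ} {f g : PowerSeries ℤ}

theorem coeff_mul_mul_pow (u : ℝ) (f g : PowerSeries ℤ) (n : ℕ) :
    ((PowerSeries.coeff n (f * g) : ℤ) : ℝ) * u ^ n =
      ∑ x ∈ Finset.HasAntidiagonal.antidiagonal n, (((PowerSeries.coeff x.1 f : ℤ) : ℝ) * u ^ x.1) *
        (((PowerSeries.coeff x.2 g : ℤ) : ℝ) * u ^ x.2) := by
  rw [PowerSeries.coeff_mul]
  push_cast
  rw [Finset.sum_mul]
  refine Finset.sum_congr rfl fun x hx => ?_
  rw [← Finset.HasAntidiagonal.mem_antidiagonal.mp hx, pow_add]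
  ring

theorem SummableAt.mul (hf : SummableAt u f) (hg : SummableAt u g) : SummableAt u (f * g) := by
  simp only [SummableAt, coeff_mul_mul_pow]
  exact summable_norm_sum_mul_antidiagonal_of_summable_norm
    (f := fun k => ((PowerSeries.coeff k f : ℤ) : ℝ) * u ^ k)
    (g := fun k => ((PowerSeries.coeff k g : ℤ) : ℝ) * u ^ k) hf hg

theorem seriesValue_mul (hf : SummableAt u f) (hg : SummableAt u g) :
    seriesValue u (f * g) = seriesValue u f * seriesValue u g := by
  simp only [seriesValue, coeff_mul_mul_pow]
  exact (tsum_mul_tsum_eq_tsum_sum_antidiagonal_of_summable_norm hf hg).symm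

theorem coeff_coe_eq_zero {p : Polynomial ℤ} {k : ℕ} (hk : k ∉ p.support) :
    ((PowerSeries.coeff k (p : PowerSeries ℤ) : ℤ) : ℝ) * u ^ k = 0 := by
  rw [Polynomial.coeff_coe, Polynomial.notMem_support_iff.mp hk]
  simp

theorem summableAt_coe (u : ℝ) (p : Polynomial ℤ) : SummableAt u (p : PowerSeries ℤ) :=
  summable_of_ne_finset_zero (s := p.support) fun k hk => by rw [coeff_coe_eq_zero hk, norm_zero]

theorem seriesValue_coe (u : ℝ) (p : Polynomial ℤ) :
    seriesValue u (p : PowerSeries ℤ) = Polynomial.aeval u p := by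
  rw [seriesValue, tsum_eq_sum (s := p.support) fun k hk => coeff_coe_eq_zero hk,
    Polynomial.aeval_eq_sum_range' (n := p.natDegree + 1) (Nat.lt_succ_self _)]
  rw [Finset.sum_subset Polynomial.supp_subset_range_natDegree_succ
    fun k _ hk => coeff_coe_eq_zero hk]
  refine Finset.sum_congr rfl fun k _ => ?_
  simp [Polynomial.coeff_coe]

/-- The power series `1 / (1 - X^k)`. -/
def geomSeries (k : ℕ) : PowerSeries ℤ := PowerSeries.mk fun n => if k ∣ n then 1 else 0

theorem one_sub_X_pow_mul_geomSeries {k : ℕ} (hk : k ≠ 0) :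
    ((1 - Polynomial.X ^ k : Polynomial ℤ) : PowerSeries ℤ) * geomSeries k = 1 := by
  have h : ((1 - Polynomial.X ^ k : Polynomial ℤ) : PowerSeries ℤ) = 1 - PowerSeries.X ^ k := by
    push_cast
    rfl
  rw [h, sub_mul, one_mul]
  ext n
  rw [map_sub, PowerSeries.coeff_X_pow_mul', PowerSeries.coeff_one, geomSeries,
    PowerSeries.coeff_mk]
  by_cases hkn : k ≤ n
  · obtain ⟨j, rfl⟩ := Nat.exists_eq_add_of_le hkn
    rw [if_pos hkn, PowerSeries.coeff_mk, if_neg (by omega : k + j ≠ 0), Nat.add_sub_cancel_left]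
    simp only [Nat.dvd_add_right (dvd_refl k), sub_self]
  · rw [if_neg hkn, sub_zero]
    by_cases hn : n = 0
    · simp [hn]
    · rw [if_neg hn, if_neg fun hdvd => hkn (Nat.le_of_dvd (Nat.pos_of_ne_zero hn) hdvd)]

theorem summableAt_geomSeries (hu0 : 0 ≤ u) (hu1 : u < 1) (k : ℕ) :
    SummableAt u (geomSeries k) := by
  refine Summable.of_nonneg_of_le (fun _ => norm_nonneg _) (fun n => ?_)
    (summable_geometric_of_lt_one hu0 hu1)
  rw [geomSeries, PowerSeries.coeff_mk, norm_mul, Real.norm_of_nonneg (pow_nonneg hu0 n)]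
  split_ifs
  · simp
  · simp [pow_nonneg hu0 n]

/-- The factors 1 - X^k are undone one at a time by multiplying with their inverse geometric series,
which converge absolutely for 0 ≤ u < 1. -/
theorem summableAt_of_prod_mul (hu0 : 0 ≤ u) (hu1 : u < 1) (l : Multiset ℕ) :
    (∀ k ∈ l, k ≠ 0) → ∀ h : PowerSeries ℤ,
    SummableAt u ((((l.map fun k => 1 - Polynomial.X ^ k).prod : Polynomial ℤ) :
      PowerSeries ℤ) * h) → SummableAt u h := by
  induction l using Multiset.induction with
  | empty => intro _ h hh; simpa using hh
  | cons k l ih =>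
    intro hl h hh
    refine ih (fun k hk => hl k (Multiset.mem_cons_of_mem hk)) h ?_
    have := (summableAt_geomSeries hu0 hu1 k).mul hh
    convert this using 1
    rw [Multiset.map_cons, Multiset.prod_cons, Polynomial.coe_mul]
    linear_combination (-(((l.map fun k => 1 - Polynomial.X ^ k).prod : Polynomial ℤ) :
      PowerSeries ℤ) * h) * one_sub_X_pow_mul_geomSeries (hl k (Multiset.mem_cons_self k l))

theorem prod_geomSeries_value (hu0 : 0 ≤ u) (hu1 : u < 1) {ι : Type*} (s : Finset ι) (N : ι → ℕ)
    (hN : ∀ i, N i ≠ 0) : SummableAt u (∏ i ∈ s, geomSeries (N i)) ∧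
      seriesValue u (∏ i ∈ s, geomSeries (N i)) * ∏ i ∈ s, (1 - u ^ N i) = 1 := by
  classical
  induction s using Finset.induction_on with
  | empty =>
    have h1 := summableAt_coe u 1
    have h2 := seriesValue_coe u 1
    simp only [Polynomial.coe_one, map_one] at h1 h2
    simpa [h2] using h1
  | insert i s hi ih =>
    have hs := summableAt_geomSeries hu0 hu1 (N i)
    have h1 : (1 - u ^ N i) * seriesValue u (geomSeries (N i)) = 1 := by
      have h2 := seriesValue_mul (summableAt_coe u (1 - Polynomial.X ^ N i)) hs
      have h3 := seriesValue_coe u 1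
      rw [one_sub_X_pow_mul_geomSeries (hN i), seriesValue_coe] at h2
      simp only [Polynomial.coe_one, map_one] at h3
      rw [h3] at h2
      simpa using h2.symm
    rw [Finset.prod_insert hi, Finset.prod_insert hi]
    refine ⟨hs.mul ih.1, ?_⟩
    rw [seriesValue_mul hs ih.1]
    linear_combination ih.2 * ((1 - u ^ N i) * seriesValue u (geomSeries (N i))) + h1

/-- A power series that dominates `∏ 1 / (1 - X^(N i))`, with `m` factors, has a pole of order
at least `m` at `1`. -/
theorem card_le_of_prod_geomSeries_le {m n : ℕ} {N : Fin m → ℕ} (hN : ∀ i, N i ≠ 0)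
    {h : PowerSeries ℤ} (hle : ∀ k, PowerSeries.coeff k (∏ i, geomSeries (N i)) ≤
      PowerSeries.coeff k h)
    {l : Multiset ℕ} (hl : ∀ k ∈ l, k ≠ 0) {a : Polynomial ℤ}
    (ha : (((l.map fun k => 1 - Polynomial.X ^ k).prod : Polynomial ℤ) : PowerSeries ℤ) * h = a)
    {B A : Polynomial ℤ} (hB : B.eval 1 ≠ 0)
    (hA : ((((Polynomial.X - 1) ^ n * B : Polynomial ℤ)) : PowerSeries ℤ) * h = A) : m ≤ n := by
  by_contra hlt
  push Not at hlt
  -- With ∏ (1 - u^{N_i}) ≤ (1 - u)^m ∏ N_i, domination bounds the value of h below by a multiple of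
  -- (1 - u)^(-m). Cancelling (1 - u)^n leaves a factor tending to 0 at u = 1 if m > n, which
  -- contradicts B(1) ≠ 0.
  have key : ∀ u ∈ Set.Ioo (0 : ℝ) 1, |Polynomial.aeval u B| ≤
      |Polynomial.aeval u A| * ((1 - u) ^ (m - n) * ∏ i, (N i : ℝ)) := by
    rintro u ⟨hu0, hu1⟩
    have hsum : SummableAt u h := summableAt_of_prod_mul hu0.le hu1 l hl h
      (by rw [ha]; exact summableAt_coe u a)
    obtain ⟨hgs, hgv⟩ := prod_geomSeries_value hu0.le hu1 Finset.univ N hN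
    have hval : (u - 1) ^ n * Polynomial.aeval u B * seriesValue u h = Polynomial.aeval u A := by
      have := seriesValue_mul (summableAt_coe u ((Polynomial.X - 1) ^ n * B)) hsum
      rw [hA, seriesValue_coe, seriesValue_coe] at this
      rw [this]
      simp
    set gv := seriesValue u (∏ i, geomSeries (N i))
    have hgh : gv ≤ seriesValue u h := by
      refine Summable.tsum_le_tsum (fun k => ?_) hgs.of_norm hsum.of_norm
      have := hle k
      gcongr
    have hprod0 : 0 ≤ ∏ i, (1 - u ^ N i) :=
      Finset.prod_nonneg fun i _ => sub_nonneg.mpr (pow_le_one₀ hu0.le hu1.le)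
    have hprod : ∏ i, (1 - u ^ N i) ≤ (1 - u) ^ m * ∏ i, (N i : ℝ) := by
      have : (1 - u) ^ m = ∏ _i : Fin m, (1 - u) := by simp
      rw [this, ← Finset.prod_mul_distrib]
      refine Finset.prod_le_prod (fun i _ => sub_nonneg.mpr (pow_le_one₀ hu0.le hu1.le))
        fun i _ => ?_
      rw [← mul_neg_geom_sum]
      refine mul_le_mul_of_nonneg_left ?_ (by linarith)
      calc ∑ j ∈ Finset.range (N i), u ^ j ≤ ∑ j ∈ Finset.range (N i), (1 : ℝ) :=
            Finset.sum_le_sum fun j _ => pow_le_one₀ hu0.le hu1.le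
        _ = N i := by simp
    have h1u : 0 < (1 - u) ^ n := pow_pos (by linarith) n
    have hgv0 : 0 ≤ seriesValue u h - gv := sub_nonneg.mpr hgh
    have hgvpos : 0 ≤ gv := by
      by_contra hneg
      push Not at hneg
      have := mul_nonpos_of_nonpos_of_nonneg hneg.le hprod0
      linarith
    have habs : (1 - u) ^ n * |Polynomial.aeval u B| * seriesValue u h =
        |Polynomial.aeval u A| := by
      rw [← hval, abs_mul, abs_mul, abs_pow, abs_sub_comm, abs_of_pos (by linarith : 0 < 1 - u),
        abs_of_nonneg (hgvpos.trans hgh)]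
    have hm : (1 - u) ^ m = (1 - u) ^ n * (1 - u) ^ (m - n) := by
      rw [← pow_add]
      congr 1
      omega
    have : (1 - u) ^ n * |Polynomial.aeval u B| ≤
        (1 - u) ^ n * (|Polynomial.aeval u A| * ((1 - u) ^ (m - n) * ∏ i, (N i : ℝ))) := by
      calc (1 - u) ^ n * |Polynomial.aeval u B|
          = (1 - u) ^ n * |Polynomial.aeval u B| * (gv * ∏ i, (1 - u ^ N i)) := by
            rw [hgv, mul_one]
        _ ≤ (1 - u) ^ n * |Polynomial.aeval u B| * (seriesValue u h * ∏ i, (1 - u ^ N i)) := by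
            gcongr
        _ = |Polynomial.aeval u A| * ∏ i, (1 - u ^ N i) := by
            rw [← habs]
            ring
        _ ≤ |Polynomial.aeval u A| * ((1 - u) ^ m * ∏ i, (N i : ℝ)) := by gcongr
        _ = _ := by
            rw [hm]
            ring
    exact le_of_mul_le_mul_left this h1u
  have hlim1 : Filter.Tendsto (fun u : ℝ => |Polynomial.aeval u B|)
      (nhdsWithin 1 (Set.Iio 1)) (nhds |Polynomial.aeval (1 : ℝ) B|) :=
    ((Polynomial.continuous_aeval B).abs.tendsto 1).mono_left nhdsWithin_le_nhds
  have hlim2 : Filter.Tendsto (fun u : ℝ =>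
      |Polynomial.aeval u A| * ((1 - u) ^ (m - n) * ∏ i, (N i : ℝ)))
      (nhdsWithin 1 (Set.Iio 1)) (nhds 0) := by
    have hc : Continuous fun u : ℝ =>
        |Polynomial.aeval u A| * ((1 - u) ^ (m - n) * ∏ i, (N i : ℝ)) := by
      have := Polynomial.continuous_aeval (A := ℝ) A
      fun_prop
    have := (hc.tendsto 1).mono_left (nhdsWithin_le_nhds (s := Set.Iio 1))
    simpa [show m - n ≠ 0 by omega] using this
  have hle0 := le_of_tendsto_of_tendsto hlim1 hlim2
    (by
      filter_upwards [Ioo_mem_nhdsLT (show (0 : ℝ) < 1 by norm_num)] with u hu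
      exact key u hu)
  have h3 : Polynomial.aeval (1 : ℝ) B = ((B.eval 1 : ℤ) : ℝ) := by
    have := Polynomial.aeval_algebraMap_apply ℝ (1 : ℤ) B
    simpa [Polynomial.coe_aeval_eq_eval] using this
  rw [h3] at hle0
  exact hB (by exact_mod_cast abs_nonpos_iff.mp hle0)

end RealValues

/-! ### Series supported on the line through d, as series in one variable -/

section Line

variable {r : ℕ}

/-- The coefficients of a power series along the line through `d`. -/
def restrictLine (d : Fin r →₀ ℕ) (F : MvPowerSeries (Fin r) ℤ) : PowerSeries ℤ :=
  PowerSeries.mk fun k => MvPowerSeries.coeff (k • d) F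

variable {d : Fin r →₀ ℕ}

theorem smul_le_smul_iff_of_ne_zero (hd : d ≠ 0) {j k : ℕ} : j • d ≤ k • d ↔ j ≤ k := by
  refine ⟨fun h => ?_, fun h => nsmul_le_nsmul_left zero_le h⟩
  obtain ⟨i, hi⟩ := DFunLike.ne_iff.mp hd
  exact Nat.le_of_mul_le_mul_right (h i) (Nat.pos_of_ne_zero hi)

theorem restrictLine_add (F F' : MvPowerSeries (Fin r) ℤ) :
    restrictLine d (F + F') = restrictLine d F + restrictLine d F' := by
  ext
  simp [restrictLine]

theorem coe_aeval_monomial (q : Polynomial ℤ) :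
    ((Polynomial.aeval (MvPolynomial.monomial d (1 : ℤ)) q : MvPolynomial (Fin r) ℤ) :
      MvPowerSeries (Fin r) ℤ) = Polynomial.aeval (MvPowerSeries.monomial d (1 : ℤ)) q := by
  induction q using Polynomial.induction_on' with
  | add p q hp hq => rw [map_add, map_add, MvPolynomial.coe_add, hp, hq]
  | monomial j a =>
    rw [Polynomial.aeval_monomial, Polynomial.aeval_monomial, MvPolynomial.coe_mul,
      MvPolynomial.coe_pow, MvPolynomial.coe_monomial, MvPolynomial.algebraMap_eq,
      MvPolynomial.coe_C, MvPowerSeries.algebraMap_apply]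
    simp

theorem coeff_C_mul_monomial_pow_mul (a : ℤ) (j : ℕ) (F : MvPowerSeries (Fin r) ℤ)
    (c : Fin r →₀ ℕ) :
    MvPowerSeries.coeff c (Polynomial.aeval (MvPowerSeries.monomial d (1 : ℤ))
      (Polynomial.monomial j a) * F) =
        if j • d ≤ c then a * MvPowerSeries.coeff (c - j • d) F else 0 := by
  have h : Polynomial.aeval (MvPowerSeries.monomial d (1 : ℤ)) (Polynomial.monomial j a) =
      MvPowerSeries.monomial (j • d) a := by
    rw [Polynomial.aeval_monomial, MvPowerSeries.monomial_pow, one_pow, ← Algebra.smul_def,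
      ← map_smul]
    simp
  rw [h, MvPowerSeries.coeff_monomial_mul]

theorem restrictLine_aeval_mul (hd : d ≠ 0) (q : Polynomial ℤ) (F : MvPowerSeries (Fin r) ℤ) :
    restrictLine d (Polynomial.aeval (MvPowerSeries.monomial d (1 : ℤ)) q * F) =
      (q : PowerSeries ℤ) * restrictLine d F := by
  induction q using Polynomial.induction_on' with
  | add p q hp hq =>
    rw [map_add, add_mul, restrictLine_add, hp, hq, Polynomial.coe_add, add_mul]
  | monomial j a =>
    ext k
    rw [restrictLine, PowerSeries.coeff_mk, coeff_C_mul_monomial_pow_mul,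
      ← Polynomial.C_mul_X_pow_eq_monomial, Polynomial.coe_mul, Polynomial.coe_C,
      Polynomial.coe_pow, Polynomial.coe_X, mul_assoc,
      PowerSeries.coeff_C_mul, PowerSeries.coeff_X_pow_mul']
    simp only [smul_le_smul_iff_of_ne_zero hd]
    split_ifs with hjk
    · obtain ⟨i, rfl⟩ := Nat.exists_eq_add_of_le hjk
      rw [add_smul, add_tsub_cancel_left, Nat.add_sub_cancel_left, restrictLine,
        PowerSeries.coeff_mk]
    · simp

theorem restrictLine_aeval (hd : d ≠ 0) (q : Polynomial ℤ) :
    restrictLine d (Polynomial.aeval (MvPowerSeries.monomial d (1 : ℤ)) q) = q := by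
  have h1 : restrictLine d (1 : MvPowerSeries (Fin r) ℤ) = 1 := by
    ext k
    rw [restrictLine, PowerSeries.coeff_mk, MvPowerSeries.coeff_one, PowerSeries.coeff_one]
    simp [hd]
  simpa [h1] using restrictLine_aeval_mul hd q 1

theorem coeff_aeval_mul_eq_zero {F : MvPowerSeries (Fin r) ℤ}
    (hF : ∀ c, (¬ ∃ n : ℕ, c = n • d) → MvPowerSeries.coeff c F = 0) (q : Polynomial ℤ)
    {c : Fin r →₀ ℕ} (hc : ¬ ∃ n : ℕ, c = n • d) :
    MvPowerSeries.coeff c (Polynomial.aeval (MvPowerSeries.monomial d (1 : ℤ)) q * F) = 0 := by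
  induction q using Polynomial.induction_on' with
  | add p q hp hq => rw [map_add, add_mul, map_add, hp, hq, add_zero]
  | monomial j a =>
    rw [coeff_C_mul_monomial_pow_mul]
    split_ifs with hjc
    · rw [hF, mul_zero]
      rintro ⟨n, hn⟩
      refine hc ⟨n + j, ?_⟩
      rw [add_smul, ← hn, tsub_add_cancel_of_le hjc]
    · rfl

theorem exists_eq_aeval_monomial {A : MvPolynomial (Fin r) ℤ}
    (hA : ∀ c, (¬ ∃ n : ℕ, c = n • d) → A.coeff c = 0) :
    ∃ a : Polynomial ℤ, A = Polynomial.aeval (MvPolynomial.monomial d (1 : ℤ)) a := by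
  suffices h : A ∈ (Polynomial.aeval (R := ℤ) (MvPolynomial.monomial d (1 : ℤ))).range by
    obtain ⟨a, ha⟩ := h
    exact ⟨a, ha.symm⟩
  rw [A.as_sum]
  refine Subalgebra.sum_mem _ fun c hc => ?_
  obtain ⟨n, rfl⟩ : ∃ n : ℕ, c = n • d := by
    by_contra hne
    exact MvPolynomial.mem_support_iff.mp hc (hA c hne)
  refine ⟨Polynomial.monomial n (A.coeff (n • d)), ?_⟩
  change Polynomial.aeval _ _ = _
  rw [Polynomial.aeval_monomial, MvPolynomial.monomial_pow, one_pow, ← Algebra.smul_def,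
    MvPolynomial.smul_monomial]
  simp

theorem exists_eq_X_sub_one_pow_mul {p : Polynomial ℤ} (hp : p ≠ 0) :
    ∃ (b : ℕ) (q : Polynomial ℤ), p = (Polynomial.X - 1) ^ b * q ∧ q.eval 1 ≠ 0 := by
  obtain ⟨q, hq, hndvd⟩ := Polynomial.exists_eq_pow_rootMultiplicity_mul_and_not_dvd p hp 1
  refine ⟨_, q, by simpa using hq, fun h => hndvd ?_⟩
  exact Polynomial.dvd_iff_isRoot.mpr h

/-- A series along the line through `d` with a pole of order at most `n` along `φ_d = 0` has,
as a series in `t^d`, a pole of order at most `n` at `1`. -/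
theorem PoleLE.exists_restrictLine (hd : d ≠ 0) {n : ℕ} {F : MvPowerSeries (Fin r) ℤ}
    (hF : ∀ c, (¬ ∃ n : ℕ, c = n • d) → MvPowerSeries.coeff c F = 0) (hF0 : F ≠ 0)
    (hpole : PoleLE d n F) {q : Polynomial ℤ} (hq0 : q ≠ 0)
    (hq : IsPoly (((Polynomial.aeval (MvPolynomial.monomial d (1 : ℤ)) q :
      MvPolynomial (Fin r) ℤ) : MvPowerSeries (Fin r) ℤ) * F)) :
    ∃ a B A : Polynomial ℤ, (q : PowerSeries ℤ) * restrictLine d F = a ∧ B.eval 1 ≠ 0 ∧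
      (((Polynomial.X - 1) ^ n * B : Polynomial ℤ) : PowerSeries ℤ) * restrictLine d F = A := by
  have hinj : Function.Injective (fun p : Polynomial ℤ =>
      (Polynomial.aeval (MvPolynomial.monomial d (1 : ℤ)) p : MvPolynomial (Fin r) ℤ)) := by
    intro p p' hpp
    have h2 := congrArg (fun z : MvPolynomial (Fin r) ℤ =>
      restrictLine d (z : MvPowerSeries (Fin r) ℤ)) hpp
    simp only [coe_aeval_monomial, restrictLine_aeval hd] at h2
    exact Polynomial.coe_injective ℤ h2
  obtain ⟨A₁, hA₁⟩ := hq
  obtain ⟨a, rfl⟩ : ∃ a : Polynomial ℤ,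
      A₁ = Polynomial.aeval (MvPolynomial.monomial d (1 : ℤ)) a := by
    refine exists_eq_aeval_monomial fun c hc => ?_
    rw [← MvPolynomial.coeff_coe, ← hA₁, coe_aeval_monomial]
    exact coeff_aeval_mul_eq_zero hF q hc
  have hqa : (q : PowerSeries ℤ) * restrictLine d F = a := by
    rw [← restrictLine_aeval_mul hd, ← coe_aeval_monomial, hA₁, coe_aeval_monomial,
      restrictLine_aeval hd]
  have hmon0 : ∀ p : Polynomial ℤ, p ≠ 0 →
      (Polynomial.aeval (MvPolynomial.monomial d (1 : ℤ)) p : MvPolynomial (Fin r) ℤ) ≠ 0 :=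
    fun p hp h => hp (hinj (by simpa using h))
  have ha0 : a ≠ 0 := by
    rintro rfl
    rw [map_zero, MvPolynomial.coe_zero] at hA₁
    rcases mul_eq_zero.mp hA₁ with h | h
    · exact hmon0 q hq0 (MvPolynomial.coe_eq_zero_iff.mp h)
    · exact hF0 h
  obtain ⟨b, B, rfl, hB⟩ := exists_eq_X_sub_one_pow_mul hq0
  obtain ⟨c, a', rfl, ha'⟩ := exists_eq_X_sub_one_pow_mul ha0
  refine ⟨_, B, (Polynomial.X - 1) ^ (n + c - b) * a', hqa, hB, ?_⟩
  obtain ⟨C, hC, A, hA⟩ := hpole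
  obtain ⟨D, hD, hDeq⟩ := one_sub_monomial_eq_phi_mul hd
  -- In lowest terms at X = 1 the restricted series has pole order b - c. Substituting X = t^d turns
  -- X - 1 into φ_d times a factor prime to φ_d, so comparing multiplicities of φ_d gives b - c ≤ n.
  have hbc : b ≤ n + c := by
    by_contra hlt
    push Not at hlt
    have hXD : (Polynomial.aeval (MvPolynomial.monomial d (1 : ℤ)) (Polynomial.X - 1 :
        Polynomial ℤ) : MvPolynomial (Fin r) ℤ) = - (phi d * D) := by
      rw [← hDeq]
      simp
    have h1 : phi d ^ n * C * Polynomial.aeval (MvPolynomial.monomial d (1 : ℤ))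
        ((Polynomial.X - 1) ^ c * a') = A * Polynomial.aeval (MvPolynomial.monomial d (1 : ℤ))
        ((Polynomial.X - 1) ^ b * B) := by
      apply MvPolynomial.coe_injective (Fin r) ℤ
      rw [MvPolynomial.coe_mul (phi d ^ n * C), MvPolynomial.coe_mul A, ← hA₁, ← hA]
      ring
    rw [map_mul, map_mul, map_pow, map_pow, hXD, neg_pow, neg_pow (phi d * D) b, mul_pow,
      mul_pow] at h1
    have hdvd : phi d ^ (n + c + 1) ∣
        phi d ^ (n + c) * (C * (D ^ c * Polynomial.aeval (MvPolynomial.monomial d (1 : ℤ)) a')) := by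
      have h2 : phi d ^ b ∣ phi d ^ (n + c) *
          (C * (D ^ c * Polynomial.aeval (MvPolynomial.monomial d (1 : ℤ)) a')) := by
        refine ⟨(-1) ^ c * (A * ((-1) ^ b * (D ^ b *
          Polynomial.aeval (MvPolynomial.monomial d (1 : ℤ)) B))), ?_⟩
        have h3 : ((-1 : MvPolynomial (Fin r) ℤ) ^ c) * (-1) ^ c = 1 := by
          rw [← mul_pow]
          simp
        rw [pow_add]
        linear_combination (-1) ^ c * h1 - phi d ^ n * phi d ^ c * C * D ^ c *
          Polynomial.aeval (MvPolynomial.monomial d (1 : ℤ)) a' * h3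
      exact (pow_dvd_pow _ hlt).trans h2
    rw [pow_succ] at hdvd
    have h4 := (mul_dvd_mul_iff_left (pow_ne_zero (n + c) (phi_ne_zero d))).mp hdvd
    rcases (prime_phi hd).dvd_or_dvd h4 with h5 | h5
    · exact hC h5
    rcases (prime_phi hd).dvd_or_dvd h5 with h6 | h6
    · exact hD ((prime_phi hd).dvd_of_dvd_pow h6)
    · exact ha' ((phi_dvd_aeval_monomial_iff hd a').mp h6)
  have hX0 : (((Polynomial.X - 1) ^ c : Polynomial ℤ) : PowerSeries ℤ) ≠ 0 := by
    rw [Ne, Polynomial.coe_eq_zero_iff]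
    exact pow_ne_zero _ (by simpa using Polynomial.X_sub_C_ne_zero (1 : ℤ))
  apply mul_left_cancel₀ hX0
  obtain ⟨k, hk⟩ := Nat.exists_eq_add_of_le hbc
  rw [hk, Nat.add_sub_cancel_left]
  have h5 : ((Polynomial.X - 1) ^ c * ((Polynomial.X - 1) ^ n * B) : Polynomial ℤ) =
      (Polynomial.X - 1) ^ k * ((Polynomial.X - 1) ^ b * B) := by
    rw [← mul_assoc, ← mul_assoc, ← pow_add, ← pow_add]
    congr 2
    omega
  rw [← mul_assoc, ← Polynomial.coe_mul, h5, Polynomial.coe_mul, mul_assoc, hqa,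
    ← Polynomial.coe_mul, ← Polynomial.coe_mul]
  congr 1
  ring

end Line

/-! ### Krull dimension: reduction to primes and integral extensions -/

section KrullDim

/-- A chain of primes over J has a smallest member P, and the whole chain already lives in R/P. -/
theorem ringKrullDim_quotient_le_of_forall_prime {R : Type*} [CommRing R] {J : Ideal R}
    {n : WithBot ℕ∞}
    (h : ∀ P : Ideal R, P.IsPrime → J ≤ P → ringKrullDim (R ⧸ P) ≤ n) :
    ringKrullDim (R ⧸ J) ≤ n := by
  rw [ringKrullDim_quotient, Order.krullDim]
  refine iSup_le fun p => ?_
  have hmono : ∀ i, p.head ≤ p i := fun i => LTSeries.head_le p i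
  refine le_trans ?_ (h p.head.1.asIdeal p.head.1.isPrime p.head.2)
  rw [ringKrullDim_quotient]
  let q : LTSeries (PrimeSpectrum.zeroLocus (p.head.1.asIdeal : Set R)) :=
    { length := p.length
      toFun := fun i => ⟨(p i).1, hmono i⟩
      step := fun i => p.step i }
  exact Order.LTSeries.length_le_krullDim q

theorem ringKrullDim_le_of_isIntegral (R S : Type*) [CommRing R] [CommRing S] [Algebra R S]
    [Algebra.IsIntegral R S] : ringKrullDim S ≤ ringKrullDim R :=
  Order.krullDim_le_of_strictMono (fun P : PrimeSpectrum S => P.comap (algebraMap R S))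
    fun P Q hPQ => Ideal.IsIntegral.comap_lt_comap (R := R) (I := P.asIdeal) (J := Q.asIdeal) hPQ

/-- Incomparability gives ≤. For ≥, lying over lifts the bottom of a chain, using injectivity, and
going up lifts the rest. -/
theorem ringKrullDim_eq_of_isIntegral (R S : Type*) [CommRing R] [CommRing S] [Algebra R S]
    [Algebra.IsIntegral R S] (hinj : Function.Injective (algebraMap R S)) :
    ringKrullDim S = ringKrullDim R := by
  refine le_antisymm (ringKrullDim_le_of_isIntegral R S) ?_
  rw [ringKrullDim, Order.krullDim]
  refine iSup_le fun l => ?_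
  obtain ⟨Q, -, hQ, hQc⟩ := Ideal.exists_ideal_over_prime_of_isIntegral (S := S)
    l.head.asIdeal ⊥ (by
      rw [← RingHom.ker_eq_comap_bot, (RingHom.injective_iff_ker_eq_bot _).mp hinj]
      exact bot_le)
  have : Q.LiesOver l.head.asIdeal := ⟨hQc.symm⟩
  obtain ⟨L, hL, -⟩ := Ideal.exists_ltSeries_of_hasGoingUp (S := S) l Q
  rw [← hL]
  exact Order.LTSeries.length_le_krullDim L

end KrullDim

/-! ### Algebraically independent homogeneous elements and the lower bound -/

section LowerBound

variable {K R : Type*} [Field K] [CommRing R] [Algebra K R] {r : ℕ}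
  (𝓡 : (Fin r →₀ ℕ) → Submodule K R)

theorem coeff_quotSeries_of_notMem (d : Fin r →₀ ℕ) {c : Fin r →₀ ℕ}
    (hc : ¬ ∃ n : ℕ, c = n • d) :
    MvPowerSeries.coeff c (quotSeries 𝓡 (offLine 𝓡 d)) = 0 := by
  have h : 𝓡 c ≤ (offLine 𝓡 d).restrictScalars K :=
    fun f hf => Ideal.subset_span ⟨c, hc, hf⟩
  rw [coeff_quotSeries, inf_eq_right.mpr h, sub_self]

variable [GradedAlgebra 𝓡]

theorem adjoin_image_homogeneous (P : Ideal R) :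
    Algebra.adjoin K (Ideal.Quotient.mk P '' {x | ∃ e, x ∈ 𝓡 e}) = ⊤ := by
  rw [eq_top_iff]
  rintro z -
  obtain ⟨x, rfl⟩ := Ideal.Quotient.mk_surjective z
  induction x using DirectSum.Decomposition.inductionOn 𝓡 with
  | zero => simp
  | @homogeneous e m => exact Algebra.subset_adjoin ⟨m, ⟨e, m.2⟩, rfl⟩
  | add a b ha hb =>
    rw [map_add]
    exact add_mem ha hb

/-- A graded affine domain `R ⧸ P`, with `P` a possibly inhomogeneous prime, has as many
algebraically independent homogeneous elements as its dimension. -/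
theorem exists_homogeneous_algebraicIndependent [Algebra.FiniteType K R] (P : Ideal R)
    [P.IsPrime] :
    ∃ (s : ℕ) (y : Fin s → R), ringKrullDim (R ⧸ P) ≤ s ∧ (∀ i, ∃ e, y i ∈ 𝓡 e) ∧
      AlgebraicIndependent K fun i => Ideal.Quotient.mk P (y i) := by
  obtain ⟨s, g, hinj, hint⟩ := exists_integral_inj_algHom_of_fg K (R ⧸ P)
  have hdim : ringKrullDim (R ⧸ P) ≤ s := by
    algebraize [g.toRingHom]
    refine (ringKrullDim_le_of_isIntegral (MvPolynomial (Fin s) K) (R ⧸ P)).trans ?_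
    rw [MvPolynomial.ringKrullDim_of_isNoetherianRing, ringKrullDim_eq_zero_of_field]
    simp
  have hindep : AlgebraicIndependent K fun i => g (MvPolynomial.X i) := by
    have : MvPolynomial.aeval (fun i => g (MvPolynomial.X i)) = g := by
      ext i
      simp
    rw [AlgebraicIndependent, this]
    exact hinj
  have halg : Algebra.IsAlgebraic
      (Algebra.adjoin K (Ideal.Quotient.mk P '' {x | ∃ e, x ∈ 𝓡 e})) (R ⧸ P) :=
    ⟨fun z => isAlgebraic_algebraMap (⟨z, by rw [adjoin_image_homogeneous]; trivial⟩ :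
      Algebra.adjoin K (Ideal.Quotient.mk P '' {x | ∃ e, x ∈ 𝓡 e}))⟩
  -- The images of homogeneous elements generate R/P, so they contain a transcendence basis; by
  -- Noether normalization it has at least s members.
  obtain ⟨t, ht, hbasis⟩ := exists_isTranscendenceBasis_subset (R := K)
    (Ideal.Quotient.mk P '' {x | ∃ e, x ∈ 𝓡 e})
  have hcard := hindep.lift_cardinalMk_le_trdeg
  have htr := hbasis.cardinalMk_eq_trdeg
  rw [← htr] at hcard
  obtain ⟨φ⟩ := Cardinal.lift_mk_le'.mp hcard
  choose y hy hyeq using fun i => ht (φ i).2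
  refine ⟨s, y, hdim, hy, ?_⟩
  simp only [hyeq]
  exact hbasis.1.comp φ φ.injective

/-- Algebraically independent elements of degrees `N i • d` bound the Hilbert function from
below. -/
theorem coeff_prod_geomSeries_le [IsNoetherianRing R] (h0 : 𝓡 0 = 1) {d : Fin r →₀ ℕ}
    {J P : Ideal R} (hJP : J ≤ P) {s : ℕ} {y : Fin s → R} {N : Fin s → ℕ}
    (hy : ∀ i, y i ∈ 𝓡 (N i • d))
    (hindep : AlgebraicIndependent K fun i => Ideal.Quotient.mk P (y i)) (k : ℕ) :
    PowerSeries.coeff k (∏ i, geomSeries (N i)) ≤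
      MvPowerSeries.coeff (k • d) (quotSeries 𝓡 J) := by
  classical
  have := finite_piece 𝓡 h0
  -- A tuple l in T stands for the monomial ∏ y_i^(l_i / N_i) of degree kd. These monomials are
  -- counted by the coefficient and are linearly independent modulo P.
  let T := (Finset.univ.finsuppAntidiag k : Finset (Fin s →₀ ℕ)).filter fun l => ∀ i, N i ∣ l i
  have hT : PowerSeries.coeff k (∏ i, geomSeries (N i)) = (T.card : ℤ) := by
    rw [PowerSeries.coeff_prod]
    simp only [geomSeries, PowerSeries.coeff_mk, Finset.prod_boole, Finset.mem_univ, true_imp_iff]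
    rw [Finset.sum_boole]
  have hmono : Module.finrank K ↥(J.restrictScalars K ⊓ 𝓡 (k • d)) ≤
      Module.finrank K ↥(P.restrictScalars K ⊓ 𝓡 (k • d)) := by
    have : Module.Finite K ↥(P.restrictScalars K ⊓ 𝓡 (k • d)) :=
      Submodule.finiteDimensional_of_le inf_le_right
    exact Submodule.finrank_mono (inf_le_inf_right _ hJP)
  set W := (𝓡 (k • d)).map (Ideal.Quotient.mkₐ K P).toLinearMap with hW
  have hrank := finrank_map_add_finrank_ker_inf (Ideal.Quotient.mkₐ K P).toLinearMap (𝓡 (k • d))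
  have hker : LinearMap.ker (Ideal.Quotient.mkₐ K P).toLinearMap = P.restrictScalars K := by
    ext x
    simp [Ideal.Quotient.eq_zero_iff_mem]
  rw [hker, ← hW] at hrank
  suffices hcard : T.card ≤ Module.finrank K W by
    rw [hT, coeff_quotSeries]
    omega
  let a : T → (Fin s →₀ ℕ) := fun l => Finsupp.equivFunOnFinite.symm fun i => l.1 i / N i
  have hdiv : ∀ (l : T) i, l.1 i = a l i * N i := fun l i =>
    (Nat.div_mul_cancel ((Finset.mem_filter.mp l.2).2 i)).symm
  have ha : Function.Injective a := fun l l' hll => by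
    refine Subtype.ext (Finsupp.ext fun i => ?_)
    rw [hdiv l i, hdiv l' i, hll]
  have hmem : ∀ l : T, (MvPolynomial.aeval fun i => Ideal.Quotient.mk P (y i))
      (MvPolynomial.monomial (a l) (1 : K)) ∈ W := by
    intro l
    refine ⟨∏ i, y i ^ a l i, ?_, ?_⟩
    · have h1 : k • d = ∑ i, a l i • N i • d := by
        have h2 : ∑ i, l.1 i = k := by
          have := (Finset.mem_finsuppAntidiag.mp (Finset.mem_filter.mp l.2).1).1
          simpa using this
        rw [← h2, Finset.sum_smul]
        refine Finset.sum_congr rfl fun i _ => ?_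
        rw [hdiv l i, mul_smul]
      rw [h1]
      exact SetLike.prod_mem_graded 𝓡 _ _ fun i _ => SetLike.pow_mem_graded _ (hy i)
    · rw [MvPolynomial.aeval_monomial, map_one, one_mul, Finsupp.prod_fintype _ _ (by simp)]
      simp
  have hlin : LinearIndependent K fun l : T => (⟨_, hmem l⟩ : W) := by
    apply LinearIndependent.of_comp W.subtype
    have h1 := (MvPolynomial.basisMonomials (Fin s) K).linearIndependent.map'
      (MvPolynomial.aeval fun i => Ideal.Quotient.mk P (y i)).toLinearMap
      (LinearMap.ker_eq_bot.mpr hindep)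
    have h2 := h1.comp a ha
    have h3 : (W.subtype ∘ fun l : T => (⟨_, hmem l⟩ : W)) =
        ((MvPolynomial.aeval fun i => Ideal.Quotient.mk P (y i)).toLinearMap ∘
          MvPolynomial.basisMonomials (Fin s) K) ∘ a := by
      ext l
      simp
    rw [h3]
    exact h2
  have := hlin.fintype_card_le_finrank
  simpa using this

/-- The order of the pole along `φ_d = 0` of the Hilbert series of the locus where the degrees
off the line through `d` vanish is at least the dimension of that locus. -/
theorem ringKrullDim_le_of_poleLE [Algebra.FiniteType K R] (h0 : 𝓡 0 = 1) {d : Fin r →₀ ℕ}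
    (hd : d ≠ 0) {n : ℕ} (hpole : PoleLE d n (quotSeries 𝓡 (offLine 𝓡 d))) :
    ringKrullDim (R ⧸ offLine 𝓡 d) ≤ n := by
  have : IsNoetherianRing R := Algebra.FiniteType.isNoetherianRing K R
  refine ringKrullDim_quotient_le_of_forall_prime fun P hP hJP => ?_
  obtain ⟨s, y, hdim, hhom, hindep⟩ := exists_homogeneous_algebraicIndependent 𝓡 P
  refine hdim.trans ?_
  choose e he using hhom
  have hline : ∀ i, ∃ k : ℕ, e i = k • d := fun i => by
    by_contra hne
    exact hindep.ne_zero i (Ideal.Quotient.eq_zero_iff_mem.mpr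
      (hJP (Ideal.subset_span ⟨e i, hne, he i⟩)))
  choose N hNe using hline
  -- An element of degree 0 is a scalar, hence not transcendental.
  have hN : ∀ i, N i ≠ 0 := fun i hi => by
    have h1 := he i
    rw [hNe, hi, zero_smul, h0, Submodule.mem_one] at h1
    obtain ⟨z, hz⟩ := h1
    refine hindep.transcendental i ?_
    rw [← hz]
    exact isAlgebraic_algebraMap (R := K) (A := R ⧸ P) z
  have hle := coeff_prod_geomSeries_le 𝓡 h0 hJP (fun i => hNe i ▸ he i) hindep
  obtain ⟨l, hl, hpoly⟩ := exists_isPoly_prod_mul_quotSeries 𝓡 h0 _ (isHomogeneous_offLine 𝓡 d)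
  -- Modulo `offLine 𝓡 d` only degrees in ℕd survive, so the Hilbert–Serre denominator is a
  -- polynomial in t^d.
  have hl' : ∃ l' : Multiset ℕ, (∀ k ∈ l', k ≠ 0) ∧ l = l'.map fun k => k • d := by
    clear hpoly
    induction l using Multiset.induction with
    | empty => exact ⟨0, by simp⟩
    | cons e l ih =>
      obtain ⟨l', hl', rfl⟩ := ih fun e' he' => hl e' (Multiset.mem_cons_of_mem he')
      obtain ⟨he0, hnle⟩ := hl e (Multiset.mem_cons_self e _)
      obtain ⟨k, rfl⟩ : ∃ k : ℕ, e = k • d := by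
        by_contra hne
        exact hnle fun f hf => Ideal.subset_span ⟨e, hne, hf⟩
      refine ⟨k ::ₘ l', fun k' hk' => ?_, by simp⟩
      rcases Multiset.mem_cons.mp hk' with rfl | hk'
      · rintro rfl
        simp at he0
      · exact hl' k' hk'
  obtain ⟨l', hl'0, rfl⟩ := hl'
  have hprod : (((l'.map fun k => k • d).map fun e => 1 - MvPolynomial.monomial e 1).prod :
      MvPolynomial (Fin r) ℤ) = Polynomial.aeval (MvPolynomial.monomial d (1 : ℤ))
        ((l'.map fun k => 1 - Polynomial.X ^ k).prod : Polynomial ℤ) := by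
    rw [map_multiset_prod, Multiset.map_map, Multiset.map_map]
    congr 1
    refine Multiset.map_congr rfl fun k _ => ?_
    simp only [Function.comp_apply]
    exact one_sub_aeval_monomial d k
  rw [hprod] at hpoly
  have hq0 : ((l'.map fun k => 1 - Polynomial.X ^ k).prod : Polynomial ℤ) ≠ 0 := by
    refine Multiset.prod_ne_zero fun hmem => ?_
    obtain ⟨k, hk, hk0⟩ := Multiset.mem_map.mp hmem
    have := congrArg (Polynomial.eval 0) hk0
    simp [hl'0 k hk] at this
  have hF0 : quotSeries 𝓡 (offLine 𝓡 d) ≠ 0 := fun hF => by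
    have h1 := hle 0
    rw [hF, map_zero, PowerSeries.coeff_zero_eq_constantCoeff_apply, map_prod] at h1
    have h2 : ∀ i, PowerSeries.constantCoeff (geomSeries (N i)) = 1 := fun i => by
      rw [← PowerSeries.coeff_zero_eq_constantCoeff_apply, geomSeries, PowerSeries.coeff_mk]
      simp
    simp [h2] at h1
  obtain ⟨a, B, A, ha, hB, hA⟩ := hpole.exists_restrictLine hd
    (fun c hc => coeff_quotSeries_of_notMem 𝓡 d hc) hF0 hq0 hpoly
  have := card_le_of_prod_geomSeries_le hN (h := restrictLine d (quotSeries 𝓡 (offLine 𝓡 d)))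
    (fun k => by rw [restrictLine, PowerSeries.coeff_mk]; exact hle k) hl'0 ha hB hA
  exact_mod_cast this

end LowerBound

/-! ### Products of the φ_d: uniqueness of exponents and lowering them -/

section Products

variable {r : ℕ}

theorem phi_pow_dvd_prod_iff {d : Fin r →₀ ℕ} (hd : d ≠ 0) (m : (Fin r →₀ ℕ) →₀ ℕ) (k : ℕ) :
    phi d ^ k ∣ m.prod (fun e a => phi e ^ a) ↔ k ≤ m d := by
  classical
  have hp := prime_phi hd
  have hnd : ¬ phi d ∣ (m.erase d).prod fun e a => phi e ^ a := by
    rw [Finsupp.prod, hp.dvd_finsetProd_iff]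
    rintro ⟨e, he, hdvd⟩
    rw [Finsupp.support_erase] at he
    have hed : e ≠ d := Finset.ne_of_mem_erase he
    have h1 := hp.dvd_of_dvd_pow hdvd
    rcases eq_or_ne e 0 with rfl | he0
    · have : phi (0 : Fin r →₀ ℕ) = 1 := by
        have : vecGcd (0 : Fin r →₀ ℕ) = 0 := Finset.gcd_eq_zero_iff.mpr fun _ _ => rfl
        simp [phi, phiOne, this]
      rw [this] at h1
      exact hp.not_isUnit (isUnit_of_dvd_one h1)
    · exact hed (eq_of_phi_dvd_phi hd he0 h1).symm
  rw [← Finsupp.mul_prod_erase' m d (fun e a => phi e ^ a) (fun _ => pow_zero _)]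
  constructor
  · intro h
    have := hp.pow_dvd_of_dvd_mul_right k hnd h
    exact (pow_dvd_pow_iff hp.ne_zero hp.not_isUnit).mp this
  · exact fun h => (pow_dvd_pow _ h).mul_right _

theorem IsUDenom.apply_eq {K R : Type*} [Field K] [CommRing R] [Algebra K R]
    {𝓡 : (Fin r →₀ ℕ) → Submodule K R} [GradedAlgebra 𝓡] {m m' : (Fin r →₀ ℕ) →₀ ℕ}
    (hm : IsUDenom 𝓡 (m.prod fun d a => phi d ^ a))
    (hm' : IsUDenom 𝓡 (m'.prod fun d a => phi d ^ a)) {d : Fin r →₀ ℕ} (hd : d ≠ 0) :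
    m d = m' d := by
  apply le_antisymm
  · rw [← phi_pow_dvd_prod_iff hd]
    exact ((phi_pow_dvd_prod_iff hd m _).mpr le_rfl).trans (hm.dvd_of_clears _ hm'.clears)
  · rw [← phi_pow_dvd_prod_iff hd]
    exact ((phi_pow_dvd_prod_iff hd m' _).mpr le_rfl).trans (hm'.dvd_of_clears _ hm.clears)

theorem exists_prod_one_sub_monomial_eq (l : Multiset (Fin r →₀ ℕ)) (hl : ∀ e ∈ l, e ≠ 0) :
    ∃ M : Multiset (Fin r →₀ ℕ), 0 ∉ M ∧
      ((l.map fun e => 1 - MvPolynomial.monomial e 1).prod : MvPolynomial (Fin r) ℤ) =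
        (M.map phi).prod := by
  induction l using Multiset.induction with
  | empty => exact ⟨0, by simp⟩
  | cons e l ih =>
    obtain ⟨M, hM, hprod⟩ := ih fun e he => hl e (Multiset.mem_cons_of_mem he)
    obtain ⟨s, hs, hes⟩ := one_sub_monomial_eq_prod (hl e (Multiset.mem_cons_self e l))
    refine ⟨s.val + M, ?_, ?_⟩
    · rw [Multiset.mem_add]
      rintro (h | h)
      · exact hs h
      · exact hM h
    · rw [Multiset.map_cons, Multiset.prod_cons, hprod, hes, Multiset.map_add, Multiset.prod_add]
      rfl

/-- Each exponent in a known denominator is replaced by the pole bound, one prime at a time; B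
collects the factors not being treated. -/
theorem isPoly_prod_mul {F : MvPowerSeries (Fin r) ℤ} {n : (Fin r →₀ ℕ) → ℕ}
    (hpole : ∀ d, d ≠ 0 → PoleLE d (n d) F) (b : (Fin r →₀ ℕ) → ℕ) (t : Finset (Fin r →₀ ℕ))
    (ht : 0 ∉ t) : ∀ B : MvPolynomial (Fin r) ℤ,
    IsPoly ((((∏ d ∈ t, phi d ^ b d) * B : MvPolynomial (Fin r) ℤ) :
      MvPowerSeries (Fin r) ℤ) * F) →
    IsPoly ((((∏ d ∈ t, phi d ^ n d) * B : MvPolynomial (Fin r) ℤ) :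
      MvPowerSeries (Fin r) ℤ) * F) := by
  classical
  induction t using Finset.induction_on with
  | empty => exact fun B h => by simpa using h
  | insert d t hdt ih =>
    intro B h
    have hd : d ≠ 0 := fun h0 => ht (h0 ▸ Finset.mem_insert_self d t)
    rw [Finset.prod_insert hdt, mul_assoc, mul_left_comm] at h
    rw [Finset.prod_insert hdt, mul_assoc]
    apply (hpole d hd).isPoly_mul hd (b := b d)
    rw [mul_left_comm]
    exact ih (fun h0 => ht (Finset.mem_insert_of_mem h0)) _ h

end Products

/-! ### Existence of the universal denominator and its exponents -/

section UniversalDenominator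

theorem exists_ringKrullDim_eq_natCast (K R : Type*) [Field K] [CommRing R] [Algebra K R]
    [Nontrivial R] [Algebra.FiniteType K R] : ∃ n : ℕ, ringKrullDim R = n := by
  obtain ⟨s, g, hinj, hint⟩ := exists_integral_inj_algHom_of_fg K R
  refine ⟨s, ?_⟩
  algebraize [g.toRingHom]
  rw [ringKrullDim_eq_of_isIntegral (MvPolynomial (Fin s) K) R hinj,
    MvPolynomial.ringKrullDim_of_isNoetherianRing, ringKrullDim_eq_zero_of_field]
  simp

variable {K R : Type*} [Field K] [CommRing R] [Algebra K R]
  {r : ℕ} (𝓡 : (Fin r →₀ ℕ) → Submodule K R)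

/-- Only finitely many lines carry a locus of positive dimension. -/
theorem exists_finset_forall_le_offLine [IsNoetherianRing R] :
    ∃ s : Finset (Fin r →₀ ℕ), ∀ d ∉ s, ∀ e, e ≠ 0 → 𝓡 e ≤ (offLine 𝓡 d).restrictScalars K := by
  classical
  obtain ⟨t, ht, hspan⟩ := (Submodule.fg_span_iff_fg_span_finset_subset (R := R)
    {f | ∃ e, e ≠ 0 ∧ f ∈ 𝓡 e}).mp (IsNoetherian.noetherian _)
  have ht' : ∀ f ∈ t, ∃ e, e ≠ 0 ∧ f ∈ 𝓡 e := fun f hf => ht hf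
  choose! E hE0 hE using ht'
  -- The components of nonzero degree lie in the ideal generated by t. If d is below no generator
  -- degree, then no generator degree is a multiple of d, so all generators lie in `offLine 𝓡 d`.
  refine ⟨t.biUnion fun f => Finset.Iic (E f), fun d hd e he f hf => ?_⟩
  have hf' : f ∈ Submodule.span R (t : Set R) :=
    hspan ▸ Submodule.subset_span ⟨e, he, hf⟩
  refine (Submodule.span_le (p := offLine 𝓡 d)).mpr (fun g hg => ?_) hf'
  refine Ideal.subset_span ⟨E g, ?_, hE g hg⟩
  rintro ⟨n, hn⟩
  refine hd (Finset.mem_biUnion.mpr ⟨g, hg, Finset.mem_Iic.mpr ?_⟩)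
  have hn0 : n ≠ 0 := by
    rintro rfl
    exact hE0 g hg (by simpa using hn)
  rw [hn]
  intro i
  exact Nat.le_mul_of_pos_left _ (Nat.pos_of_ne_zero hn0)

variable [GradedAlgebra 𝓡]

theorem offLine_ne_top [Nontrivial R] (d : Fin r →₀ ℕ) : offLine 𝓡 d ≠ ⊤ := by
  have hle : offLine 𝓡 d ≤ RingHom.ker (GradedRing.projZeroRingHom 𝓡) := by
    refine Ideal.span_le.mpr ?_
    rintro f ⟨e, hne, hf⟩
    rw [SetLike.mem_coe, RingHom.mem_ker, GradedRing.projZeroRingHom_apply]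
    refine DirectSum.decompose_of_mem_ne 𝓡 hf ?_
    rintro rfl
    exact hne ⟨0, by simp⟩
  intro htop
  rw [htop, top_le_iff] at hle
  exact RingHom.ker_ne_top _ hle

/-- The universal denominator of a graded algebra, in terms of the dimensions of the loci where
all degrees off a line vanish. -/
theorem exists_isUDenom [Nontrivial R] [Algebra.FiniteType K R] (h0 : 𝓡 0 = 1) :
    ∃ m : (Fin r →₀ ℕ) →₀ ℕ, IsUDenom 𝓡 (m.prod fun d a => phi d ^ a) ∧
      ∀ d, d ≠ 0 → ringKrullDim (R ⧸ offLine 𝓡 d) = m d := by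
  classical
  have hnoeth : IsNoetherianRing R := Algebra.FiniteType.isNoetherianRing K R
  have hdim : ∀ d, ∃ n : ℕ, ringKrullDim (R ⧸ offLine 𝓡 d) = n := fun d => by
    have := Ideal.Quotient.nontrivial_iff.mpr (offLine_ne_top 𝓡 d)
    exact exists_ringKrullDim_eq_natCast K _
  choose δ hδ using hdim
  have hpole : ∀ I : Ideal R, I.IsHomogeneous 𝓡 → ∀ d, d ≠ 0 →
      PoleLE d (δ d) (quotSeries 𝓡 I) := fun I hI d hd =>
    poleLE_quotSeries 𝓡 h0 hd I hI _
      ((ringKrullDim_quotient_mono le_sup_right).trans (hδ d).le)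
  obtain ⟨s, hs⟩ := exists_finset_forall_le_offLine 𝓡
  have hδ0 : ∀ d ∉ s, d ≠ 0 → δ d = 0 := fun d hd hd0 => by
    have := ringKrullDim_le_of_poleLE 𝓡 h0 hd0 (n := 0)
      ((isPoly_quotSeries_of_forall_le 𝓡 (hs d hd)).poleLE hd0)
    rw [hδ d] at this
    have : δ d ≤ 0 := by exact_mod_cast this
    omega
  -- The exponent at 0 is set to 0, as φ_0 = 1 is no prime; the support then consists of indices of
  -- pairwise non-associated primes.
  let m : (Fin r →₀ ℕ) →₀ ℕ := Finsupp.onFinset s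
    (fun d => if d ∈ s ∧ d ≠ 0 then δ d else 0) fun d hd => by
      by_contra hds
      simp [hds] at hd
  have hm : ∀ d, d ≠ 0 → m d = δ d := fun d hd => by
    simp only [m, Finsupp.onFinset_apply]
    by_cases hds : d ∈ s
    · rw [if_pos ⟨hds, hd⟩]
    · rw [if_neg fun h => hds h.1, hδ0 d hds hd]
  have hm0 : m 0 = 0 := by simp [m]
  have hclear : ∀ I : Ideal R, I.IsHomogeneous 𝓡 →
      IsPoly (((m.prod fun d a => phi d ^ a : MvPolynomial (Fin r) ℤ) :
        MvPowerSeries (Fin r) ℤ) * quotSeries 𝓡 I) := by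
    intro I hI
    obtain ⟨l, hl, hpoly⟩ := exists_isPoly_prod_mul_quotSeries 𝓡 h0 I hI
    obtain ⟨M, hM, hprod⟩ := exists_prod_one_sub_monomial_eq l fun e he => (hl e he).1
    rw [hprod, Finset.prod_multiset_map_count, ← mul_one (∏ _ ∈ _, _)] at hpoly
    have h1 := isPoly_prod_mul (hpole I hI) (fun d => M.count d) M.toFinset (by simpa using hM) 1
      hpoly
    refine h1.of_dvd ?_
    rw [mul_one]
    have h2 : ∏ d ∈ M.toFinset, phi d ^ δ d = ∏ d ∈ M.toFinset, phi d ^ m d :=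
      Finset.prod_congr rfl fun d hd => by
        rw [hm d fun h => hM (h ▸ Multiset.mem_toFinset.mp hd)]
    rw [h2, Finsupp.prod_of_support_subset m (Finset.subset_union_right (s₁ := M.toFinset)) _
      fun _ _ => pow_zero _]
    exact Finset.prod_dvd_prod_of_subset _ _ _ Finset.subset_union_left
  refine ⟨m, ⟨⟨?_, fun N hN => ?_⟩, fun B' hB' => ?_⟩, fun d hd => by rw [hm d hd, hδ d]⟩
  · simp [Finsupp.prod, constantCoeff_phi]
  · obtain ⟨A, hA⟩ := hclear ⊥ (Ideal.IsHomogeneous.bot 𝓡)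
    obtain ⟨A', hA'⟩ := hclear N hN
    refine ⟨A - A', ?_⟩
    rw [hilbertSeries_eq, mul_sub, hA, hA']
    exact (map_sub (MvPolynomial.coeToMvPowerSeries.ringHom (σ := Fin r) (R := ℤ)) A A').symm
  · have hB0 : B' ≠ 0 := by
      rintro rfl
      simpa using hB'.constantCoeff_eq_one
    refine Finset.prod_dvd_of_isRelPrime ?_ ?_
    · intro d hd e he hde
      have hd0 : d ≠ 0 := fun h => Finsupp.mem_support_iff.mp hd (h ▸ hm0)
      have he0 : e ≠ 0 := fun h => Finsupp.mem_support_iff.mp he (h ▸ hm0)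
      refine IsRelPrime.pow ?_
      exact ((prime_phi hd0).irreducible.isRelPrime_iff_not_dvd).mpr fun h =>
        hde (eq_of_phi_dvd_phi hd0 he0 h)
    · intro d hd
      have hd0 : d ≠ 0 := fun h => Finsupp.mem_support_iff.mp hd (h ▸ hm0)
      obtain ⟨n, C, hC, hBC⟩ := WfDvdMonoid.max_power_factor' hB0 (prime_phi hd0).not_isUnit
      -- For minimality two test ideals suffice, the whole ring and `offLine 𝓡 d`: their difference
      -- is the series of V_d, whose pole order is at least its dimension.
      have hp : PoleLE d n (quotSeries 𝓡 (offLine 𝓡 d)) := by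
        refine ⟨C, hC, ?_⟩
        rw [← hBC, quotSeries]
        obtain ⟨A, hA⟩ := hB'.exists_polynomial ⊤ (Ideal.IsHomogeneous.top 𝓡)
        obtain ⟨A', hA'⟩ := hB'.exists_polynomial _ (isHomogeneous_offLine 𝓡 d)
        refine ⟨A - A', ?_⟩
        rw [mul_sub, hA, hA']
        exact (map_sub (MvPolynomial.coeToMvPowerSeries.ringHom (σ := Fin r) (R := ℤ)) A A').symm
      have hle := ringKrullDim_le_of_poleLE 𝓡 h0 hd0 hp
      rw [hδ d] at hle
      have hle' : δ d ≤ n := by exact_mod_cast hle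
      rw [hBC, hm d hd0]
      exact (pow_dvd_pow _ hle').mul_right _

end UniversalDenominator

/-! ### Characters trivial on a dense generator of T^{[d]} -/

section Torus

variable {K : Type*} [Field K] {r : ℕ}

theorem character_smul (n : ℕ) (d : Fin r →₀ ℕ) (t : Fin r → Kˣ) :
    character (n • d) t = character d t ^ n := by
  simp [character, ← Finset.prod_pow, pow_mul']

/-- The characters on the image of a cocharacter. -/
theorem character_zpow (e : Fin r →₀ ℕ) (lam : Fin r → ℤ) (s : Kˣ) :
    character e (fun i => s ^ lam i) = s ^ (∑ i, lam i * (e i : ℤ)) := by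
  change ∏ i, (s ^ lam i) ^ e i = _
  have h : ∀ t : Finset (Fin r), ∏ i ∈ t, (s ^ lam i) ^ e i = s ^ (∑ i ∈ t, lam i * (e i : ℤ)) := by
    intro t
    induction t using Finset.induction_on with
    | empty => simp
    | insert i t hi ih =>
      rw [Finset.prod_insert hi, Finset.sum_insert hi, zpow_add, ih, zpow_mul, zpow_natCast]
  exact h Finset.univ

theorem eq_zero_of_forall_zpow_eq_one [Infinite K] {N : ℤ} (h : ∀ s : Kˣ, s ^ N = 1) :
    N = 0 := by
  by_contra hN
  have hpow : ∀ s : Kˣ, s ^ N.natAbs = 1 := fun s => by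
    rcases Int.natAbs_eq N with h1 | h1
    · have := h s
      rw [h1, zpow_natCast] at this
      exact this
    · have := h s
      rw [h1, zpow_neg, inv_eq_one, zpow_natCast] at this
      exact this
  have hX : (Polynomial.X ^ (N.natAbs + 1) : Polynomial K) = Polynomial.X := by
    refine Polynomial.funext fun x => ?_
    rcases eq_or_ne x 0 with rfl | hx
    · simp
    · have := congrArg Units.val (hpow (Units.mk0 x hx))
      simp only [Units.val_pow_eq_pow_val, Units.val_mk0, Units.val_one] at this
      simp [pow_succ, this]
  have := congrArg Polynomial.natDegree hX
  rw [Polynomial.natDegree_X_pow, Polynomial.natDegree_X] at this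
  omega

/-- If `d` is not divisible by the characteristic, then only the multiples of `d` are trivial on
a dense generator of `T^{[d]}`. -/
theorem character_eq_one_iff [IsAlgClosed K] (p : ℕ) [CharP K p] {d : Fin r →₀ ℕ}
    (hd : ¬ ∀ i, p ∣ d i) {ζ : Fin r → Kˣ} (hζ : GeneratesDense d ζ) (e : Fin r →₀ ℕ) :
    character e ζ = 1 ↔ ∃ n : ℕ, e = n • d := by
  constructor
  swap
  · rintro ⟨n, rfl⟩
    have : character d ζ = 1 := hζ.1
    rw [character_smul, this, one_pow]
  intro he
  -- The polynomial t^e - 1 vanishes on all powers of ζ, hence on their closure T^{[d]}.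
  have hker : ∀ t : Fin r → Kˣ, character d t = 1 → character e t = 1 := by
    intro t ht
    have hmem : t ∈ zariskiClosure (Subgroup.zpowers ζ : Set (Fin r → Kˣ)) := by
      rw [hζ.2]
      exact ht
    have heval : ∀ s : Fin r → Kˣ, MvPolynomial.eval (fun i => (s i : K))
        (MvPolynomial.monomial e 1 - 1) = (character e s : K) - 1 := fun s => by
      rw [map_sub, MvPolynomial.eval_monomial, Finsupp.prod_fintype _ _ (by simp)]
      simp [character]
    have h1 := hmem (MvPolynomial.monomial e 1 - 1) fun s hs => by
      obtain ⟨k, rfl⟩ := Subgroup.mem_zpowers_iff.mp hs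
      rw [heval, map_zpow, he]
      simp
    rw [heval, sub_eq_zero] at h1
    exact Units.ext h1
  have hd0 : d ≠ 0 := by
    rintro rfl
    simp at hd
  obtain ⟨v, c, hc, hv⟩ := exists_eq_vecGcd_smul hd0
  set k := vecGcd d with hk
  have hk0 : 0 < k := Nat.pos_of_ne_zero (vecGcd_ne_zero hd0)
  have hdv : ∀ i, (d i : ℤ) = k * v i := fun i => by
    conv_lhs => rw [hv]
    simp
  have hinf : Infinite K := inferInstance
  rw [hv]
  refine exists_eq_smul_of_proportional hc hk0 (fun i j => ?_) ?_
  -- The one-parameter subgroup with weight v_j at i and -v_i at j lies in T^{[d]}. Triviality of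
  -- t^e on all of these makes e proportional to v.
  · have h1 : ∀ f : Fin r →₀ ℕ, ∑ l, (Pi.single i (v j : ℤ) - Pi.single j (v i : ℤ) :
        Fin r → ℤ) l * (f l : ℤ) = v j * f i - v i * f j := fun f => by
      simp [sub_mul, Finset.sum_sub_distrib, Pi.single_apply]
    refine sub_eq_zero.mp (eq_zero_of_forall_zpow_eq_one (K := K) fun s => ?_)
    rw [← h1 e, ← character_zpow]
    refine hker _ ?_
    rw [character_zpow, h1, hdv, hdv]
    have : (v j : ℤ) * (k * v i) - v i * (k * v j) = 0 := by ring
    rw [this, zpow_zero]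
  -- Since p does not divide d, it does not divide k, so K has a primitive k-th root of unity u. The
  -- point (u^{c_i}) lies in T^{[d]}, and t^e = 1 there means that k divides the Bezout form of e.
  · have hkp : NeZero (k : K) := ⟨fun h => hd fun i => by
      rw [CharP.cast_eq_zero_iff K p] at h
      exact h.trans (vecGcd_dvd d i)⟩
    obtain ⟨η, hη⟩ := IsAlgClosed.exists_root (Polynomial.cyclotomic k K)
      (Polynomial.degree_cyclotomic_pos k K hk0).ne'
    rw [Polynomial.isRoot_cyclotomic_iff] at hη
    obtain ⟨u, rfl⟩ := hη.isUnit hk0.ne'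
    have hu : IsPrimitiveRoot u k := IsPrimitiveRoot.coe_units_iff.mp hη
    rw [← hu.zpow_eq_one_iff_dvd, ← character_zpow]
    refine hker _ ?_
    rw [character_zpow]
    have : ∑ i, c i * (d i : ℤ) = k := by
      simp only [hdv, mul_left_comm _ (k : ℤ), ← Finset.mul_sum, hc, mul_one]
    rw [this, zpow_natCast, hu.pow_eq_one]

end Torus

/-! ### Points of an affine algebra and the Nullstellensatz -/

section Points

variable {K S : Type*} [Field K] [CommRing S] [Algebra K S]

theorem algHom_ext_of_ker_eq {y z : S →ₐ[K] K} (h : RingHom.ker y = RingHom.ker z) : y = z := by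
  ext x
  have h1 : x - algebraMap K S (y x) ∈ RingHom.ker y := by simp [RingHom.mem_ker]
  rw [h, RingHom.mem_ker, map_sub, AlgHom.commutes, sub_eq_zero] at h1
  exact h1.symm

theorem exists_ker_eq_of_isMaximal [IsAlgClosed K] [Algebra.FiniteType K S] (m : Ideal S)
    (hm : m.IsMaximal) : ∃ y : S →ₐ[K] K, RingHom.ker y = m := by
  let _ : Field (S ⧸ m) := Ideal.Quotient.field m
  have : Module.Finite K (S ⧸ m) := finite_of_finite_type_of_isJacobsonRing K (S ⧸ m)
  have hbij : Function.Bijective (algebraMap K (S ⧸ m)) :=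
    IsAlgClosed.algebraMap_bijective_of_isIntegral
  let φ : K ≃ₐ[K] S ⧸ m := AlgEquiv.ofBijective (Algebra.ofId K (S ⧸ m)) hbij
  refine ⟨(φ.symm : S ⧸ m →ₐ[K] K).comp (Ideal.Quotient.mkₐ K m), ?_⟩
  ext x
  simp [RingHom.mem_ker, Ideal.Quotient.eq_zero_iff_mem]

theorem mem_vanishingIdeal {Z : Set (S →ₐ[K] K)} {f : S} :
    f ∈ vanishingIdeal Z ↔ ∀ y ∈ Z, y f = 0 := by
  simp [vanishingIdeal, Submodule.mem_iInf, RingHom.mem_ker]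

/-- The Nullstellensatz for an affine algebra. -/
theorem vanishingIdeal_le_of_isPrime [IsAlgClosed K] [Algebra.FiniteType K S] (Q : Ideal S)
    [hQ : Q.IsPrime] : vanishingIdeal {y : S →ₐ[K] K | Q ≤ RingHom.ker y} ≤ Q := by
  have : IsJacobsonRing S := isJacobsonRing_of_finiteType (A := K)
  intro f hf
  rw [← this.out hQ.isRadical, Ideal.jacobson, Ideal.mem_sInf]
  rintro m ⟨hQm, hm⟩
  obtain ⟨y, rfl⟩ := exists_ker_eq_of_isMaximal (K := K) m hm
  exact mem_vanishingIdeal.mp hf y hQm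

end Points

/-! ### The invariant ring and the eigenloci -/

section Invariants

theorem invGrading_zero (G : Type*) {K S : Type*} [Field K] [CommRing S] [Algebra K S] [Group G]
    [MulSemiringAction G S] [SMulCommClass G K S] {r : ℕ} (𝒜 : (Fin r →₀ ℕ) → Submodule K S)
    (h𝒜 : 𝒜 0 = 1) : invGrading G 𝒜 0 = 1 := by
  ext x
  have h : x ∈ invGrading G 𝒜 0 ↔ (x : S) ∈ 𝒜 0 := Iff.rfl
  rw [h, h𝒜, Submodule.mem_one, Submodule.mem_one]
  exact exists_congr fun a => ⟨fun hx => Subtype.ext hx, fun hx => congrArg Subtype.val hx⟩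

variable (G : Type*) {K S : Type*} [Field K] [CommRing S] [Algebra K S] [Group G] [Finite G]
  [MulSemiringAction G S] [SMulCommClass G K S]

instance isInvariant_fixedPoints :
    Algebra.IsInvariant (FixedPoints.subalgebra K S G) S G :=
  ⟨fun b hb => ⟨⟨b, hb⟩, rfl⟩⟩

theorem isIntegral_fixedPoints : Algebra.IsIntegral (FixedPoints.subalgebra K S G) S :=
  Algebra.IsInvariant.isIntegral _ S G

/-- Noether's finiteness theorem: S is finite over S^G, and the Artin–Tate lemma descends finite
generation. -/
theorem finiteType_fixedPoints [Algebra.FiniteType K S] :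
    Algebra.FiniteType K (FixedPoints.subalgebra K S G) := by
  have := isIntegral_fixedPoints G (K := K) (S := S)
  have h1 : Algebra.FiniteType (FixedPoints.subalgebra K S G) S :=
    Algebra.FiniteType.of_restrictScalars_finiteType K _ S
  have h2 : Module.Finite (FixedPoints.subalgebra K S G) S := Algebra.IsIntegral.finite
  exact ⟨fg_of_fg_of_fg K (FixedPoints.subalgebra K S G) S Algebra.FiniteType.out h2.fg_top
    Subtype.val_injective⟩

variable {r : ℕ} (𝒜 : (Fin r →₀ ℕ) → Submodule K S) [GradedAlgebra 𝒜] [GradedAction G 𝒜]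

variable {G}

theorem torusPoint_apply_of_mem (ζ : Fin r → Kˣ) (y : S →ₐ[K] K) {e : Fin r →₀ ℕ} {f : S}
    (hf : f ∈ 𝒜 e) : torusPoint 𝒜 ζ y f = ((character e ζ)⁻¹ : Kˣ) * y f := by
  rw [torusPoint, AlgHom.comp_apply, torusAct_of_mem 𝒜 _ hf, map_inv, map_smul, smul_eq_mul]

/-- A point lies over the locus of the quotient where the degrees off the line through `d` vanish
exactly if `ζ` moves it within its orbit. -/
theorem offLine_le_comap_ker_iff {d : Fin r →₀ ℕ} {ζ : Fin r → Kˣ}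
    (hζ : ∀ e, character e ζ = 1 ↔ ∃ n : ℕ, e = n • d) (y : S →ₐ[K] K) :
    offLine (invGrading G 𝒜) d ≤
        (RingHom.ker y).comap (algebraMap (FixedPoints.subalgebra K S G) S) ↔
      ∃ g : G, y ∈ eigenLocus 𝒜 g ζ := by
  constructor
  · intro h
    -- On an invariant of degree e, ζ multiplies the value by ζ^(-e). This is 1 for e ∈ ℕd, and
    -- otherwise the value is 0.
    have hagree : ∀ f : FixedPoints.subalgebra K S G, torusPoint 𝒜 ζ y (f : S) = y (f : S) := by
      intro f
      induction f using DirectSum.Decomposition.inductionOn (invGrading G 𝒜) with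
      | zero => simp
      | @homogeneous e m =>
        rw [torusPoint_apply_of_mem 𝒜 ζ y (e := e) (f := ((m : FixedPoints.subalgebra K S G) : S))
          m.2]
        by_cases he : ∃ n : ℕ, e = n • d
        · rw [(hζ e).mpr he]
          simp
        · have h1 : y ((m : FixedPoints.subalgebra K S G) : S) = 0 :=
            h (Ideal.subset_span ⟨e, he, m.2⟩)
          rw [h1, mul_zero]
      | add a b ha hb =>
        rw [AddMemClass.coe_add, map_add, map_add, ha, hb]
    have hunder : (RingHom.ker y).under (FixedPoints.subalgebra K S G) =
        (RingHom.ker (torusPoint 𝒜 ζ y)).under (FixedPoints.subalgebra K S G) := by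
      ext f
      change y (f : S) = 0 ↔ torusPoint 𝒜 ζ y (f : S) = 0
      rw [hagree]
    have hprime : ∀ z : S →ₐ[K] K, (RingHom.ker z).IsPrime := fun z => RingHom.ker_isPrime z
    -- G acts transitively on the primes of S over a given prime of S^G.
    obtain ⟨g, hg⟩ := Algebra.IsInvariant.exists_smul_of_under_eq
      (FixedPoints.subalgebra K S G) S G _ _ hunder
    refine ⟨g, algHom_ext_of_ker_eq ?_⟩
    rw [hg]
    ext x
    rw [Ideal.mem_pointwise_smul_iff_inv_smul_mem]
    rfl
  · rintro ⟨g, hg⟩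
    refine Ideal.span_le.mpr ?_
    rintro f ⟨e, he, hf⟩
    change y (f : S) = 0
    have h1 := DFunLike.congr_fun (show groupPoint g y = torusPoint 𝒜 ζ y from hg) (f : S)
    rw [torusPoint_apply_of_mem 𝒜 ζ y (e := e) (f := (f : S)) hf] at h1
    have h2 : groupPoint g y (f : S) = y (f : S) := by
      change y (g⁻¹ • (f : S)) = _
      rw [f.2 g⁻¹]
    rw [h2] at h1
    by_contra hy
    refine he ((hζ e).mp ?_)
    have h3 : (((character e ζ)⁻¹ : Kˣ) : K) = 1 := by
      have h4 : (((character e ζ)⁻¹ : Kˣ) : K) * y (f : S) = 1 * y (f : S) := by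
        rw [one_mul]
        exact h1.symm
      exact mul_right_cancel₀ hy h4
    exact inv_eq_one.mp (Units.ext h3)

/-- The dimension of the locus of the quotient where the degrees off the line through `d` vanish
is the largest dimension of an eigenlocus. -/
theorem isGreatest_algDim_eigenLocus [IsAlgClosed K] [Algebra.FiniteType K S]
    {d : Fin r →₀ ℕ} {ζ : Fin r → Kˣ} (hζ : ∀ e, character e ζ = 1 ↔ ∃ n : ℕ, e = n • d) :
    IsGreatest (Set.range fun g : G => algDim (eigenLocus 𝒜 g ζ))
      (ringKrullDim (FixedPoints.subalgebra K S G ⧸ offLine (invGrading G 𝒜) d)) := by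
  have hint := isIntegral_fixedPoints G (K := K) (S := S)
  let R := FixedPoints.subalgebra K S G
  let J : Ideal S := ⨅ g : G, vanishingIdeal (eigenLocus 𝒜 g ζ)
  have hRJ : ringKrullDim (S ⧸ J) = ringKrullDim (R ⧸ J.comap (algebraMap R S)) :=
    ringKrullDim_eq_of_isIntegral (R ⧸ J.comap (algebraMap R S)) (S ⧸ J)
      Ideal.algebraMap_quotient_injective
  have hoff : offLine (invGrading G 𝒜) d ≤ J.comap (algebraMap R S) := by
    intro f hf
    rw [Ideal.mem_comap, Submodule.mem_iInf]
    exact fun g => mem_vanishingIdeal.mpr fun y hy =>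
      (offLine_le_comap_ker_iff 𝒜 hζ y).mpr ⟨g, hy⟩ hf
  have hdim : ringKrullDim (R ⧸ offLine (invGrading G 𝒜) d) = ringKrullDim (S ⧸ J) := by
    rw [hRJ]
    refine le_antisymm (ringKrullDim_quotient_le_of_forall_prime fun P hP hle => ?_)
      (ringKrullDim_quotient_mono hoff)
    refine ringKrullDim_quotient_mono ?_
    -- For a prime Q over P, every point of V(Q) lies over V_d, hence in some eigenlocus, so J
    -- vanishes on V(Q). By the Nullstellensatz J ≤ Q, and P contains the contraction of J.
    obtain ⟨Q, -, hQ, rfl⟩ := Ideal.exists_ideal_over_prime_of_isIntegral (S := S) P ⊥ (by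
      rw [← RingHom.ker_eq_comap_bot,
        (RingHom.injective_iff_ker_eq_bot (algebraMap R S)).mp Subtype.val_injective]
      exact bot_le)
    refine Ideal.comap_mono fun f hf => vanishingIdeal_le_of_isPrime (K := K) Q ?_
    refine mem_vanishingIdeal.mpr fun y hy => ?_
    obtain ⟨g, hg⟩ := (offLine_le_comap_ker_iff 𝒜 hζ y).mp (hle.trans (Ideal.comap_mono hy))
    exact mem_vanishingIdeal.mp ((Submodule.mem_iInf _).mp hf g) y hg
  rw [hdim]
  have hle : ∀ g : G, algDim (eigenLocus 𝒜 g ζ) ≤ ringKrullDim (S ⧸ J) := fun g =>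
    ringKrullDim_quotient_mono (iInf_le _ g)
  obtain ⟨g₀, hg₀⟩ := Finite.exists_max fun g : G => algDim (eigenLocus 𝒜 g ζ)
  refine ⟨⟨g₀, le_antisymm (hle g₀) ?_⟩, ?_⟩
  · refine ringKrullDim_quotient_le_of_forall_prime fun P hP hJP => ?_
    have := Fintype.ofFinite G
    have hinf : J = Finset.univ.inf fun g : G => vanishingIdeal (eigenLocus 𝒜 g ζ) := by
      rw [Finset.inf_univ_eq_iInf]
    -- A prime containing a finite intersection of ideals contains one of them; this turns the
    -- dimension of the union into a maximum.
    rw [hinf, hP.inf_le'] at hJP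
    obtain ⟨g, -, hg⟩ := hJP
    exact (ringKrullDim_quotient_mono hg).trans (hg₀ g)
  · rintro _ ⟨g, rfl⟩
    exact hle g

end Invariants

end UDenom

end

open UDenom in
theorem mainTheorem5 {K S G : Type*} [Field K] [IsAlgClosed K] (p : ℕ) [CharP K p]
    [CommRing S] [Nontrivial S] [Algebra K S] [Algebra.FiniteType K S]
    {r : ℕ} (𝒜 : (Fin r →₀ ℕ) → Submodule K S) [GradedAlgebra 𝒜]
    (h𝒜 : 𝒜 0 = 1)
    [Group G] [Finite G] [MulSemiringAction G S] [SMulCommClass G K S] [GradedAction G 𝒜] :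
    (∃ m : (Fin r →₀ ℕ) →₀ ℕ, IsUDenom (invGrading G 𝒜) (m.prod fun d a => phi d ^ a)) ∧
    ∀ m : (Fin r →₀ ℕ) →₀ ℕ, IsUDenom (invGrading G 𝒜) (m.prod fun d a => phi d ^ a) →
      ∀ d : Fin r →₀ ℕ, ¬ (∀ i, p ∣ d i) →
        ∀ ζ : Fin r → Kˣ, GeneratesDense d ζ →
          IsGreatest (Set.range fun g : G => algDim (eigenLocus 𝒜 g ζ))
            ((m d : ℕ) : WithBot ℕ∞) := by
  have := finiteType_fixedPoints G (K := K) (S := S)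
  obtain ⟨m₀, hm₀, hdim⟩ := exists_isUDenom (invGrading G 𝒜) (invGrading_zero G 𝒜 h𝒜)
  refine ⟨⟨m₀, hm₀⟩, fun m hm d hd ζ hζ => ?_⟩
  have hd0 : d ≠ 0 := by
    rintro rfl
    simp at hd
  rw [hm.apply_eq hm₀ hd0, ← hdim d hd0]
  exact isGreatest_algDim_eigenLocus 𝒜 (character_eq_one_iff p hd hζ)
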